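/- **Programs.** Let $C$ be an infinite set of symbolic constants. *Precomputed terms* are numerals $n\in\mathbb Z$, symbolic constants, $\mathit{inf}$, $\mathit{sup}$, and tuples $(r_1,\dots,r_k)$ of precomputed terms; they are totally ordered so that $\mathit{inf}$ is least, $\mathit{sup}$ is greatest, numerals are ordered as integers, and every numeral precedes every symbolic constant. *Program terms* are built from numerals, symbolic constants, variables, $\mathit{inf}$, $\mathit{sup}$ by $t_1+t_2$, $t_1-t_2$, $t_1\times t_2$, $t_1/t_2$, $t_1\backslash t_2$, intervals $t_1..t_2$, tuples $(t_1,\dots,t_k)$ and pools $(t_1;\dots;t_k)$. *Atoms* are $p(t_1,\dots,t_k)$ and $p(t_1;\dots;t_k)$ with $p\in C$; a predicate symbol is a name together with its arity. A *rule* $H\leftarrow B_1\wedge\dots\wedge B_n$ has as $H$ an atom $A$, a simple choice $\{A\}$, or nothing, and each $B_i$ is $A$, $\mathit{not}\,A$, $\mathit{not\,not}\,A$ or a comparison $t_1\sim t_2$ with $\sim\,\in\{=,\ne,<,>,\le,\ge\}$. A *program* is a finite set of rules. **Answer sets.** The set $[t]$ of values of a ground term is defined as follows: a precomputed constant has itself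 as its only value; for $\circ\in\{+,-,\times\}$, $[t_1\circ t_2]=\{m\circ n\}$, and $[t_1/t_2]=\{q\}$, $[t_1\backslash t_2]=\{r\}$, $[t_1..t_2]=\{k : m\le k\le n\}$ for all integers $m\in[t_1]$, $n\in[t_2]$, where for $/$ and $\backslash$ one requires $n\neq0$ and $m=nq+r$, $0\le r<|n|$; $[(t_1,\dots,t_k)]=\{(r_1,\dots,r_k): r_i\in[t_i]\}$; $[(t_1;\dots;t_k)]=[t_1]\cup\dots\cup[t_k]$. A ground atom $A$ stands for the set $[A]$ of the precomputed atoms $p(r_1,\dots,r_k)$ with $r_i\in[t_i]$ if $A=p(t_1,\dots,t_k)$, and of the $p(r)$ with $r\in[t_1]\cup\dots\cup[t_k]$ if $A=p(t_1;\dots;t_k)$. A ground rule is turned into the infinitary propositional implication from the conjunction of its body to its head, where body expressions become $\bigvee_{a\in[A]}a$, $\bigvee_{a\in[A]}\neg a$, $\bigvee_{a\in[A]}\neg\neg a$, and, for $t_1\sim t_2$, $\top$ if $r_1\sim r_2$ for some $r_i\in[t_i]$ and $\bot$ otherwise, and heads become $\bigwedge_{a\in[A]}a$, $\bigwedge_{a\in[A]}(a\vee\neg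 a)$, $\bot$, respectively. The *answer sets* of $\Pi$ are the stable models (sets $X$ of precomputed atoms that are minimal models of the reduct with respect to $X$) of the set of formulas so obtained from all instances of rules of $\Pi$ under substitutions of precomputed terms for variables. Programs $\Pi_1,\Pi_2$ are *strongly equivalent* if $\Pi_1\cup\Pi$ and $\Pi_2\cup\Pi$ have the same answer sets for every program $\Pi$. **The translation $\tau^*$** goes to a first-order language with program variables and integer variables. The formula $\mathit{val}_t(Z)$ is (with all quantified variables fresh; $I,J,K,Q,R$ integer variables, $I_1,\dots,I_k$ program variables): - $Z=t$ if $t$ is a numeral, a symbolic constant, a variable, $\mathit{inf}$ or $\mathit{sup}$; - $\exists IJ(Z=I\circ J\wedge \mathit{val}_{t_1}(I)\wedge \mathit{val}_{t_2}(J))$ if $t=t_1\circ t_2$ with $\circ\in\{+,-,\times\}$; - $\exists IJQR(I=J\times Q+R\wedge \mathit{val}_{t_1}(I)\wedge \mathit{val}_{t_2}(J)\wedge J\neq0\wedge R\ge0\wedge R<|J|\wedge Z=Q)$ if $t=t_1/t_2$, and the same with $Z=R$ in place of $Z=Q$ if $t=t_1\backslash t_2$, where $R<|J|$ stands for $R<J\vee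 R<0-J$; - $\exists IJK(\mathit{val}_{t_1}(I)\wedge \mathit{val}_{t_2}(J)\wedge I\le K\wedge K\le J\wedge Z=K)$ if $t=t_1..t_2$; - $\exists I_1\dots I_k(Z=(I_1,\dots,I_k)\wedge \mathit{val}_{t_1}(I_1)\wedge\dots\wedge \mathit{val}_{t_k}(I_k))$ if $t=(t_1,\dots,t_k)$; - $\exists I_1\dots I_k((\mathit{val}_{t_1}(I_1)\wedge Z=I_1)\vee\dots\vee(\mathit{val}_{t_k}(I_k)\wedge Z=I_k))$ if $t=(t_1;\dots;t_k)$. For $L$ one of $p(\vec t)$, $\mathit{not}\,p(\vec t)$, $\mathit{not\,not}\,p(\vec t)$ with $\vec t=t_1,\dots,t_k$, $\tau^B(L)$ is $\exists Z_1\dots Z_k(\bigwedge_i\mathit{val}_{t_i}(Z_i)\wedge\lambda)$ with $\lambda$ being $p(\vec Z)$, $\neg p(\vec Z)$, $\neg\neg p(\vec Z)$, respectively; for a pooled atom $p(t_1;\dots;t_k)$ in place of $p(\vec t)$ it is the disjunction of the formulas $\tau^B$ obtained with $p(t_i)$; $\tau^B(t_1\sim t_2)$ is $\exists Z_1Z_2(\mathit{val}_{t_1}(Z_1)\wedge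 \mathit{val}_{t_2}(Z_2)\wedge Z_1\sim Z_2)$. $\tau^H(p(\vec t))$ is $\forall Z_1\dots Z_k(\bigwedge_i\mathit{val}_{t_i}(Z_i)\to p(\vec Z))$, $\tau^H(\{p(\vec t)\})$ is the same with $p(\vec Z)\vee\neg p(\vec Z)$ as the consequent; for pooled atoms it is the conjunction of the formulas $\tau^H$ obtained with $p(t_i)$; $\tau^H$ of the empty head is $\bot$. $\tau^*(H\leftarrow B_1\wedge\dots\wedge B_n)$ is the universal closure of $\tau^B(B_1)\wedge\dots\wedge\tau^B(B_n)\to\tau^H(H)$, and $\tau^*\Pi$ is the (conjunction of the) finite set of the formulas $\tau^*R$, $R\in\Pi$. **The transformation $\sigma^*$.** For every predicate symbol $p$ let $p'$ be a new predicate symbol of the same arity, and let $F'$ be $F$ with every $p$ replaced by $p'$. $\sigma^*$ leaves predicate atoms, comparisons, $\top$ and $\bot$ unchanged, commutes with $\wedge,\vee,\forall,\exists$, and $\sigma^*(\neg F)=\neg F'$, $\sigma^*(F\to G)=(\sigma^*(F)\to\sigma^*(G))\wedge(F'\to G')$. The *prime axioms* are $\forall\vec X(p(\vec X)\to p'(\vec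 X))$ for all predicate symbols $p$. A *standard interpretation* of the primed and unprimed symbols is a classical interpretation in which program variables range over the precomputed terms, integer variables over the numerals, and terms and comparisons have their intended meaning; only the extents of the predicate symbols are free. **Theorem.** Let $\Pi_1,\Pi_2$ be programs. Then $\Pi_1$ and $\Pi_2$ are strongly equivalent if and only if the formula $$\sigma^*(\tau^*\Pi_1)\leftrightarrow\sigma^*(\tau^*\Pi_2)$$ is satisfied by every standard interpretation that satisfies the prime axioms. -/

import Mathlib

universe u

noncomputable section

namespace ASP

/-! ## The input language -/

/-- Precomputed terms over the set `C` of symbolic constants: numerals, symbolic constants,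
`inf`, `sup`, and tuples of precomputed terms. -/
inductive PTerm (C : Type u) : Type u
  | num (n : ℤ)
  | sym (c : C)
  | inf
  | sup
  | tuple (rs : List (PTerm C))

/-- What is required of the total order on precomputed terms that interprets the comparison
symbols. -/
structure IsTermOrder (C : Type u) [LinearOrder (PTerm C)] : Prop where
  inf_le : ∀ r : PTerm C, PTerm.inf ≤ r
  le_sup : ∀ r : PTerm C, r ≤ PTerm.sup
  num_lt_num : ∀ m n : ℤ, (PTerm.num m : PTerm C) < PTerm.num n ↔ m < n
  num_lt_sym : ∀ (n : ℤ) (c : C), (PTerm.num n : PTerm C) < PTerm.sym c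

/-- The operations `+`, `-`, `×`. -/
inductive Op
  | add
  | sub
  | mul

def Op.apply : Op → ℤ → ℤ → ℤ
  | .add, m, n => m + n
  | .sub, m, n => m - n
  | .mul, m, n => m * n

/-- The comparison symbols `=`, `≠`, `<`, `>`, `≤`, `≥`. -/
inductive Rel
  | eq
  | ne
  | lt
  | gt
  | le
  | ge

def Rel.Holds {α : Type u} [LinearOrder α] : Rel → α → α → Prop
  | .eq, a, b => a = b
  | .ne, a, b => a ≠ b
  | .lt, a, b => a < b
  | .gt, a, b => a > b
  | .le, a, b => a ≤ b
  | .ge, a, b => a ≥ b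

/-- Program terms. The variables of programs are indexed by natural numbers. -/
inductive Term (C : Type u) : Type u
  | num (n : ℤ)
  | sym (c : C)
  | inf
  | sup
  | var (x : ℕ)
  | arith (o : Op) (s t : Term C)
  | div (s t : Term C)
  | mod (s t : Term C)
  | interval (s t : Term C)
  | tuple (ts : List (Term C))
  | pool (ts : List (Term C))

/-- Atoms `p(t₁, …, tₖ)` and pooled atoms `p(t₁; …; tₖ)`. -/
inductive Atom (C : Type u) : Type u
  | args (p : C) (ts : List (Term C))
  | pool (p : C) (ts : List (Term C))

/-- Body expressions: `A`, `not A`, `not not A`, and comparisons `s ∼ t`. -/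
inductive BodyExpr (C : Type u) : Type u
  | pos (a : Atom C)
  | naf (a : Atom C)
  | nafnaf (a : Atom C)
  | cmp (r : Rel) (s t : Term C)

/-- Heads: `A` (basic rule), `{A}` (choice rule), or empty (constraint). -/
inductive Head (C : Type u) : Type u
  | basic (a : Atom C)
  | choice (a : Atom C)
  | empty

structure Rule (C : Type u) : Type u where
  head : Head C
  body : List (BodyExpr C)

/-- A program is a finite set of rules. -/
abbrev Program (C : Type u) : Type u := Finset (Rule C)

/-- A precomputed atom `p(r₁, …, rₖ)`. Predicate symbols are pairs of a name and an arity,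
the arity being the length of the list of arguments. -/
abbrev GAtom (C : Type u) : Type u := C × List (PTerm C)

/-! ## Infinitary propositional formulas and their stable models -/

inductive IForm (A : Type u) : Type (u + 1)
  | atom (a : A)
  | conj {ι : Type u} (f : ι → IForm A)
  | disj {ι : Type u} (f : ι → IForm A)
  | imp (F G : IForm A)

namespace IForm

variable {A : Type u}

def bot : IForm A := disj (fun i : PEmpty.{u + 1} => i.elim)

def top : IForm A := conj (fun i : PEmpty.{u + 1} => i.elim)

def neg (F : IForm A) : IForm A := imp F bot

def or (F G : IForm A) : IForm A := disj (fun b : ULift.{u} Bool => cond b.down F G)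

/-- Classical satisfaction by a set of atoms. -/
def Sat (X : Set A) : IForm A → Prop
  | atom a => a ∈ X
  | conj f => ∀ i, Sat X (f i)
  | disj f => ∃ i, Sat X (f i)
  | imp F G => Sat X F → Sat X G

open Classical in
/-- The reduct of a formula with respect to `X`. -/
def reduct (X : Set A) : IForm A → IForm A
  | atom a => if a ∈ X then atom a else bot
  | conj f => conj (fun i => reduct X (f i))
  | disj f => disj (fun i => reduct X (f i))
  | imp F G => if Sat X (imp F G) then imp (reduct X F) (reduct X G) else bot

/-- `X` is a stable model of `Γ`: a minimal model of the reduct of `Γ` with respect to `X`. -/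
def IsStableModel (Γ : Set (IForm A)) (X : Set A) : Prop :=
  Minimal (fun Y : Set A => ∀ F ∈ Γ, Sat Y (reduct X F)) X

end IForm

/-! ## Answer sets and strong equivalence -/

section Semantics

variable {C : Type u}

mutual

/-- `values θ t` is the set of values of the ground term that is obtained from `t` by the
substitution `θ` of precomputed terms for variables. For integers, `m / n` and `m % n` denote
the quotient and the remainder of the division with remainder in `{0, …, |n| - 1}`. -/
def values (θ : ℕ → PTerm C) : Term C → Set (PTerm C)
  | .num n => {PTerm.num n}
  | .sym c => {PTerm.sym c}
  | .inf => {PTerm.inf}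
  | .sup => {PTerm.sup}
  | .var x => {θ x}
  | .arith o s t =>
      {r | ∃ m n : ℤ, PTerm.num m ∈ values θ s ∧ PTerm.num n ∈ values θ t ∧
        r = PTerm.num (o.apply m n)}
  | .div s t =>
      {r | ∃ m n : ℤ, PTerm.num m ∈ values θ s ∧ PTerm.num n ∈ values θ t ∧ n ≠ 0 ∧
        r = PTerm.num (m / n)}
  | .mod s t =>
      {r | ∃ m n : ℤ, PTerm.num m ∈ values θ s ∧ PTerm.num n ∈ values θ t ∧ n ≠ 0 ∧
        r = PTerm.num (m % n)}
  | .interval s t =>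
      {r | ∃ m n k : ℤ, PTerm.num m ∈ values θ s ∧ PTerm.num n ∈ values θ t ∧
        m ≤ k ∧ k ≤ n ∧ r = PTerm.num k}
  | .tuple ts => {r | ∃ rs ∈ tupleValues θ ts, r = PTerm.tuple rs}
  | .pool ts => poolValues θ ts

/-- All lists `r₁, …, rₖ` such that `rᵢ` is a value of `tᵢ` for every `i`. -/
def tupleValues (θ : ℕ → PTerm C) : List (Term C) → Set (List (PTerm C))
  | [] => {[]}
  | t :: ts => {l | ∃ r ∈ values θ t, ∃ rs ∈ tupleValues θ ts, l = r :: rs}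

/-- The union of the sets of values of `t₁, …, tₖ`. -/
def poolValues (θ : ℕ → PTerm C) : List (Term C) → Set (PTerm C)
  | [] => ∅
  | t :: ts => values θ t ∪ poolValues θ ts

end

/-- The precomputed atoms that an atom stands for, under the substitution `θ`. -/
def Atom.values (θ : ℕ → PTerm C) : Atom C → Set (GAtom C)
  | .args p ts => {a | ∃ rs ∈ tupleValues θ ts, a = (p, rs)}
  | .pool p ts => {a | ∃ r ∈ poolValues θ ts, a = (p, [r])}

open Classical in
def BodyExpr.ground [LinearOrder (PTerm C)] (θ : ℕ → PTerm C) :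
    BodyExpr C → IForm (GAtom C)
  | .pos a => .disj (fun x : a.values θ => .atom x.1)
  | .naf a => .disj (fun x : a.values θ => .neg (.atom x.1))
  | .nafnaf a => .disj (fun x : a.values θ => .neg (.neg (.atom x.1)))
  | .cmp r s t =>
      if ∃ a ∈ ASP.values θ s, ∃ b ∈ ASP.values θ t, r.Holds a b then .top else .bot

def Head.ground (θ : ℕ → PTerm C) : Head C → IForm (GAtom C)
  | .basic a => .conj (fun x : a.values θ => .atom x.1)
  | .choice a => .conj (fun x : a.values θ => .or (.atom x.1) (.neg (.atom x.1)))
  | .empty => .bot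

/-- The infinitary formula for the instance of a rule under the substitution `θ`. -/
def Rule.ground [LinearOrder (PTerm C)] (θ : ℕ → PTerm C) (R : Rule C) : IForm (GAtom C) :=
  .imp (.conj (fun b : {b : BodyExpr C // b ∈ R.body} => b.1.ground θ)) (R.head.ground θ)

/-- The infinitary formulas for all ground instances of all rules of a program. -/
def Program.ground [LinearOrder (PTerm C)] (Γ : Program C) : Set (IForm (GAtom C)) :=
  {F | ∃ R ∈ Γ, ∃ θ : ℕ → PTerm C, F = R.ground θ}

def IsAnswerSet [LinearOrder (PTerm C)] (Γ : Program C) (X : Set (GAtom C)) : Prop :=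
  IForm.IsStableModel (Program.ground Γ) X

open Classical in
def StronglyEquivalent [LinearOrder (PTerm C)] (Γ₁ Γ₂ : Program C) : Prop :=
  ∀ Γ : Program C, {X | IsAnswerSet (Γ₁ ∪ Γ) X} = {X | IsAnswerSet (Γ₂ ∪ Γ) X}

end Semantics

/-! ## The two-sorted first-order language and its standard interpretations -/

/-- Variables of formulas of the sort of program variables: the variables of programs, and a
supply of further ones. -/
inductive PVar
  | user (x : ℕ)
  | aux (n : ℕ)
  deriving DecidableEq

/-- Integer terms; integer variables are indexed by natural numbers. -/
inductive IntTerm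
  | num (n : ℤ)
  | var (i : ℕ)
  | op (o : Op) (s t : IntTerm)

/-- Terms of the first-order language; the integer sort is a subsort of the main sort. -/
inductive FTerm (C : Type u) : Type u
  | sym (c : C)
  | inf
  | sup
  | var (x : PVar)
  | int (t : IntTerm)
  | tuple (ts : List (FTerm C))

/-- First-order formulas with predicate names from `P`, and with quantifiers over program
variables (`all`, `ex`) and over integer variables (`allInt`, `exInt`). -/
inductive Formula (C P : Type u) : Type u
  | bot
  | top
  | pred (p : P) (ts : List (FTerm C))
  | cmp (r : Rel) (s t : FTerm C)
  | neg (F : Formula C P)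
  | and (F G : Formula C P)
  | or (F G : Formula C P)
  | imp (F G : Formula C P)
  | all (x : PVar) (F : Formula C P)
  | ex (x : PVar) (F : Formula C P)
  | allInt (i : ℕ) (F : Formula C P)
  | exInt (i : ℕ) (F : Formula C P)

def IntTerm.eval (z : ℕ → ℤ) : IntTerm → ℤ
  | .num n => n
  | .var i => z i
  | .op o s t => o.apply (s.eval z) (t.eval z)

mutual

def FTerm.eval {C : Type u} (e : PVar → PTerm C) (z : ℕ → ℤ) : FTerm C → PTerm C
  | .sym c => .sym c
  | .inf => .inf
  | .sup => .sup
  | .var x => e x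
  | .int t => .num (t.eval z)
  | .tuple ts => .tuple (FTerm.evalList e z ts)

def FTerm.evalList {C : Type u} (e : PVar → PTerm C) (z : ℕ → ℤ) :
    List (FTerm C) → List (PTerm C)
  | [] => []
  | t :: ts => FTerm.eval e z t :: FTerm.evalList e z ts

end

/-- In a standard interpretation, program variables range over the precomputed terms and
integer variables over the numerals, ground terms and comparisons have their intended meaning.
Such an interpretation is determined by the extents of the predicate symbols (name and arity). -/
abbrev Interp (C P : Type u) : Type u := Set (P × List (PTerm C))

namespace Formula

variable {C P Q : Type u}

/-- Classical (Tarskian) satisfaction in a standard interpretation, for assignments `e` of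
precomputed terms to program variables and `z` of integers to integer variables. -/
def Sat [LinearOrder (PTerm C)] (I : Interp C P) :
    Formula C P → (PVar → PTerm C) → (ℕ → ℤ) → Prop
  | bot, _, _ => False
  | top, _, _ => True
  | pred p ts, e, z => (p, FTerm.evalList e z ts) ∈ I
  | cmp r s t, e, z => r.Holds (s.eval e z) (t.eval e z)
  | neg F, e, z => ¬ Sat I F e z
  | and F G, e, z => Sat I F e z ∧ Sat I G e z
  | or F G, e, z => Sat I F e z ∨ Sat I G e z
  | imp F G, e, z => Sat I F e z → Sat I G e z
  | all x F, e, z => ∀ r, Sat I F (Function.update e x r) z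
  | ex x F, e, z => ∃ r, Sat I F (Function.update e x r) z
  | allInt i F, e, z => ∀ n, Sat I F e (Function.update z i n)
  | exInt i F, e, z => ∃ n, Sat I F e (Function.update z i n)

/-- An interpretation satisfies a formula if it does so under all assignments; for closed
formulas the assignment is irrelevant. -/
def Satisfies [LinearOrder (PTerm C)] (I : Interp C P) (F : Formula C P) : Prop :=
  ∀ e z, Sat I F e z

def iff (F G : Formula C P) : Formula C P := and (imp F G) (imp G F)

def conj (l : List (Formula C P)) : Formula C P := l.foldr and top

def disj (l : List (Formula C P)) : Formula C P := l.foldr or bot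

def allList (xs : List PVar) (F : Formula C P) : Formula C P := xs.foldr all F

def exList (xs : List PVar) (F : Formula C P) : Formula C P := xs.foldr ex F

/-- Renaming of predicate symbols. -/
def mapPred (f : P → Q) : Formula C P → Formula C Q
  | bot => bot
  | top => top
  | pred p ts => pred (f p) ts
  | cmp r s t => cmp r s t
  | neg F => neg (mapPred f F)
  | and F G => and (mapPred f F) (mapPred f G)
  | or F G => or (mapPred f F) (mapPred f G)
  | imp F G => imp (mapPred f F) (mapPred f G)
  | all x F => all x (mapPred f F)
  | ex x F => ex x (mapPred f F)
  | allInt i F => allInt i (mapPred f F)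
  | exInt i F => exInt i (mapPred f F)

end Formula

/-! ## The translation `τ*` -/

section Translation

variable {C : Type u}

/-- The integer variable with index `i`, as a term of the first-order language. -/
abbrev ivar (C : Type u) (i : ℕ) : FTerm C := .int (.var i)

/-- The variables `aux d, …, aux (d + k - 1)`. -/
def auxVars (d k : ℕ) : List PVar := (List.range' d k).map PVar.aux

/-- The condition common to division and modulo: `I = J × Q + R`, `J ≠ 0`, `R ≥ 0` and
`R < |J|`, where `I`, `J`, `Q`, `R` are the integer variables `d`, `d + 1`, `d + 2`, `d + 3`.
The last condition is spelled out as `R < J ∨ R < 0 - J`. -/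
def divisionCondition (C : Type u) (d : ℕ) : List (Formula C C) :=
  [.cmp .eq (ivar C d)
      (.int (.op .add (.op .mul (.var (d + 1)) (.var (d + 2))) (.var (d + 3)))),
    .cmp .ne (ivar C (d + 1)) (.int (.num 0)),
    .cmp .ge (ivar C (d + 3)) (.int (.num 0)),
    .or (.cmp .lt (ivar C (d + 3)) (ivar C (d + 1)))
      (.cmp .lt (ivar C (d + 3)) (.int (.op .sub (.num 0) (.var (d + 1)))))]

mutual

/-- `val d t Z` is the formula `val_t(Z)` expressing that `Z` is one of the values of `t`. All
variables that it binds are auxiliary program variables and integer variables of index at least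
`d`; it is used only for `Z` in which no such variable occurs, so they are fresh. -/
def val (d : ℕ) : Term C → FTerm C → Formula C C
  | .num n, Z => .cmp .eq Z (.int (.num n))
  | .sym c, Z => .cmp .eq Z (.sym c)
  | .inf, Z => .cmp .eq Z .inf
  | .sup, Z => .cmp .eq Z .sup
  | .var x, Z => .cmp .eq Z (.var (.user x))
  | .arith o s t, Z =>
      .exInt d <| .exInt (d + 1) <| .conj
        [.cmp .eq Z (.int (.op o (.var d) (.var (d + 1)))),
          val (d + 2) s (ivar C d), val (d + 2) t (ivar C (d + 1))]
  | .div s t, Z =>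
      .exInt d <| .exInt (d + 1) <| .exInt (d + 2) <| .exInt (d + 3) <| .conj
        ([val (d + 4) s (ivar C d), val (d + 4) t (ivar C (d + 1))] ++ divisionCondition C d ++
          [.cmp .eq Z (ivar C (d + 2))])
  | .mod s t, Z =>
      .exInt d <| .exInt (d + 1) <| .exInt (d + 2) <| .exInt (d + 3) <| .conj
        ([val (d + 4) s (ivar C d), val (d + 4) t (ivar C (d + 1))] ++ divisionCondition C d ++
          [.cmp .eq Z (ivar C (d + 3))])
  | .interval s t, Z =>
      .exInt d <| .exInt (d + 1) <| .exInt (d + 2) <| .conj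
        [val (d + 3) s (ivar C d), val (d + 3) t (ivar C (d + 1)),
          .cmp .le (ivar C d) (ivar C (d + 2)), .cmp .le (ivar C (d + 2)) (ivar C (d + 1)),
          .cmp .eq Z (ivar C (d + 2))]
  | .tuple ts, Z =>
      .exList (auxVars d ts.length) <| .conj
        (.cmp .eq Z (.tuple ((auxVars d ts.length).map .var)) ::
          valList (d + ts.length) d ts)
  | .pool ts, Z =>
      .exList (auxVars d ts.length) <| .disj <|
        List.zipWith (fun F I => .and F (.cmp .eq Z (.var I)))
          (valList (d + ts.length) d ts) (auxVars d ts.length)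

/-- The formulas `val_{t₁}(Zᵢ), val_{t₂}(Zᵢ₊₁), …` for the auxiliary variables `Zᵢ = aux i`,
with bound variables of index at least `d`. -/
def valList (d : ℕ) (i : ℕ) : List (Term C) → List (Formula C C)
  | [] => []
  | t :: ts => val d t (.var (.aux i)) :: valList d (i + 1) ts

end

/-- `∃ Z₁ … Zₖ (val_{t₁}(Z₁) ∧ … ∧ val_{tₖ}(Zₖ) ∧ F(Z₁, …, Zₖ))` -/
def exVal (ts : List (Term C)) (F : List (FTerm C) → Formula C C) : Formula C C :=
  .exList (auxVars 0 ts.length) <|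
    .conj (valList ts.length 0 ts ++ [F ((auxVars 0 ts.length).map .var)])

/-- `∀ Z₁ … Zₖ (val_{t₁}(Z₁) ∧ … ∧ val_{tₖ}(Zₖ) → F(Z₁, …, Zₖ))` -/
def allVal (ts : List (Term C)) (F : List (FTerm C) → Formula C C) : Formula C C :=
  .allList (auxVars 0 ts.length) <|
    .imp (.conj (valList ts.length 0 ts)) (F ((auxVars 0 ts.length).map .var))

def BodyExpr.tauB : BodyExpr C → Formula C C
  | .pos (.args p ts) => exVal ts (fun Z => .pred p Z)
  | .naf (.args p ts) => exVal ts (fun Z => .neg (.pred p Z))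
  | .nafnaf (.args p ts) => exVal ts (fun Z => .neg (.neg (.pred p Z)))
  | .pos (.pool p ts) => .disj (ts.map fun t => exVal [t] (fun Z => .pred p Z))
  | .naf (.pool p ts) => .disj (ts.map fun t => exVal [t] (fun Z => .neg (.pred p Z)))
  | .nafnaf (.pool p ts) =>
      .disj (ts.map fun t => exVal [t] (fun Z => .neg (.neg (.pred p Z))))
  | .cmp r s t =>
      .ex (.aux 0) <| .ex (.aux 1) <| .conj
        [val 2 s (.var (.aux 0)), val 2 t (.var (.aux 1)),
          .cmp r (.var (.aux 0)) (.var (.aux 1))]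

def Head.tauH : Head C → Formula C C
  | .basic (.args p ts) => allVal ts (fun Z => .pred p Z)
  | .basic (.pool p ts) => .conj (ts.map fun t => allVal [t] (fun Z => .pred p Z))
  | .choice (.args p ts) => allVal ts (fun Z => .or (.pred p Z) (.neg (.pred p Z)))
  | .choice (.pool p ts) =>
      .conj (ts.map fun t => allVal [t] (fun Z => .or (.pred p Z) (.neg (.pred p Z))))
  | .empty => .bot

mutual

def Term.vars : Term C → Finset ℕ
  | .num _ => ∅
  | .sym _ => ∅
  | .inf => ∅
  | .sup => ∅
  | .var x => {x}
  | .arith _ s t => s.vars ∪ t.vars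
  | .div s t => s.vars ∪ t.vars
  | .mod s t => s.vars ∪ t.vars
  | .interval s t => s.vars ∪ t.vars
  | .tuple ts => Term.varsList ts
  | .pool ts => Term.varsList ts

def Term.varsList : List (Term C) → Finset ℕ
  | [] => ∅
  | t :: ts => t.vars ∪ Term.varsList ts

end

def Atom.vars : Atom C → Finset ℕ
  | .args _ ts => Term.varsList ts
  | .pool _ ts => Term.varsList ts

def BodyExpr.vars : BodyExpr C → Finset ℕ
  | .pos a => a.vars
  | .naf a => a.vars
  | .nafnaf a => a.vars
  | .cmp _ s t => s.vars ∪ t.vars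

def Head.vars : Head C → Finset ℕ
  | .basic a => a.vars
  | .choice a => a.vars
  | .empty => ∅

def Rule.vars (R : Rule C) : Finset ℕ :=
  R.body.foldr (fun b s => b.vars ∪ s) R.head.vars

/-- The universal closure of `τᴮ(B₁) ∧ … ∧ τᴮ(Bₙ) → τᴴ(H)`; the free variables of this formula
are the variables of the rule. -/
def Rule.tauStar (R : Rule C) : Formula C C :=
  .allList ((R.vars.sort (· ≤ ·)).map .user) <|
    .imp (.conj (R.body.map BodyExpr.tauB)) R.head.tauH

open Classical in
/-- The set of the formulas `τ* R` for all rules `R` of a program. -/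
def Program.tauStar (Γ : Program C) : Finset (Formula C C) := Finset.image Rule.tauStar Γ

end Translation

/-! ## The transformation `σ*` -/

/-- The predicate names `p` and `p'`, for `p` in `P`. -/
inductive Primed (P : Type u) : Type u
  | plain (p : P)
  | prime (p : P)

section Sigma

variable {C P : Type u}

/-- `F'`: every predicate name `p` is replaced by `p'`. -/
def Formula.primed (F : Formula C P) : Formula C (Primed P) := F.mapPred .prime

def Formula.sigmaStar : Formula C P → Formula C (Primed P)
  | .bot => .bot
  | .top => .top
  | .pred p ts => .pred (.plain p) ts
  | .cmp r s t => .cmp r s t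
  | .neg F => .neg F.primed
  | .and F G => .and F.sigmaStar G.sigmaStar
  | .or F G => .or F.sigmaStar G.sigmaStar
  | .imp F G => .and (.imp F.sigmaStar G.sigmaStar) (.imp F.primed G.primed)
  | .all x F => .all x F.sigmaStar
  | .ex x F => .ex x F.sigmaStar
  | .allInt i F => .allInt i F.sigmaStar
  | .exInt i F => .exInt i F.sigmaStar

/-- The prime axiom `∀ X₁ … Xₙ (p(X₁, …, Xₙ) → p'(X₁, …, Xₙ))` for the predicate symbol with
name `p` and arity `n`. -/
def primeAxiom (C : Type u) {P : Type u} (p : P) (n : ℕ) : Formula C (Primed P) :=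
  .allList (auxVars 0 n) <|
    .imp (.pred (.plain p) ((auxVars 0 n).map .var)) (.pred (.prime p) ((auxVars 0 n).map .var))

def SatisfiesPrimeAxioms [LinearOrder (PTerm C)] (I : Interp C (Primed P)) : Prop :=
  ∀ (p : P) (n : ℕ), (primeAxiom C p n).Satisfies I

/-- The conjunction of a finite set of formulas. -/
def Formula.conjSet (Γ : Finset (Formula C P)) : Formula C P := .conj Γ.toList

end Sigma

end ASP

end

open ASP

namespace ASP

variable {C P : Type u}

-- Both sides of the theorem say that the two programs have the same here-and-there (HT) models,
-- these being pairs `H ⊆ T` of sets of precomputed atoms.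
--
-- Formulas: an interpretation of the unprimed and primed symbols is a pair `(H, T)`, the prime
-- axioms say `H ⊆ T`, and σ* spells out HT satisfaction clause by clause (`Formula.sat_sigmaStar`).
-- Since val_t defines the set of values of t (`valCorrect`), τ* of a rule holds in `(H, T)` iff all
-- instances of the rule do (`Rule.ht_tauStar`).
--
-- Answer sets: for `Y ⊆ X`, the set `Y` satisfies the reduct of a ground rule with respect to `X`
-- iff `(Y, X)` satisfies the rule in HT (`Rule.sat_reduct_ground`). So `X` is an answer set iff
-- `(X, X)` is an HT model and no `(Y, X)` with `Y` a proper subset of `X` is one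
-- (`isAnswerSet_iff`). The HT models of a union are the common HT models, so equality of HT models
-- gives strong equivalence.
--
-- For the converse, let `(H, T)` be an HT model of Γ₁ but not of Γ₂. The usual separating context
-- lists the atoms of `H` as facts, but these may be infinitely many and a program is finite.
-- Instead, only finitely many predicate symbols matter, and as `C` is infinite each has a fresh
-- copy h(p). A finite context Δ (`exists_context`) chooses the copied atoms freely and derives each
-- atom from its copy; if the smaller world has an atom without a copy in the larger one, then Δ
-- makes the smaller world contain all of `T`. First, T ∪ h(T) is an answer set of Γ₁ ∪ Δ, hence of
-- Γ₂ ∪ Δ, so `(T, T)` is a model of Γ₂. Then T ∪ h(H) is an answer set of Γ₂ ∪ Δ, but not of Γ₁ ∪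
-- Δ, where H ∪ h(H) is a smaller world.

/-- Structural induction on program terms, with the induction hypothesis for every member of a
tuple or a pool. -/
theorem Term.induct {M : Term C → Prop} (num : ∀ n, M (.num n)) (sym : ∀ c, M (.sym c))
    (inf : M .inf) (sup : M .sup) (var : ∀ x, M (.var x))
    (arith : ∀ o s t, M s → M t → M (.arith o s t)) (div : ∀ s t, M s → M t → M (.div s t))
    (mod : ∀ s t, M s → M t → M (.mod s t))
    (interval : ∀ s t, M s → M t → M (.interval s t))
    (tuple : ∀ ts, (∀ t ∈ ts, M t) → M (.tuple ts)) (pool : ∀ ts, (∀ t ∈ ts, M t) → M (.pool ts))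
    (t : Term C) : M t :=
  Term.rec (motive_1 := M) (motive_2 := fun ts => ∀ t ∈ ts, M t)
    num sym inf sup var arith div mod interval tuple pool
    (fun _ h => absurd h List.not_mem_nil)
    (fun _ _ hs hts _ h => (List.mem_cons.1 h).elim (fun e => e ▸ hs) (hts _)) t

-- Worlds of an interpretation and assignments to auxiliary variables

def plainPart (I : Interp C (Primed P)) : Interp C P := {a | (.plain a.1, a.2) ∈ I}

def primePart (I : Interp C (Primed P)) : Interp C P := {a | (.prime a.1, a.2) ∈ I}

/-- The assignment `e`, changed to map `aux d, aux (d + 1), …` to the members of a list. -/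
def setAux (e : PVar → PTerm C) (d : ℕ) : List (PTerm C) → PVar → PTerm C
  | [] => e
  | r :: rs => setAux (Function.update e (.aux d) r) (d + 1) rs

theorem setAux_user (e : PVar → PTerm C) (d : ℕ) (rs : List (PTerm C)) (x : ℕ) :
    setAux e d rs (.user x) = e (.user x) := by
  induction rs generalizing e d <;> simp_all [setAux]

theorem setAux_comp_user (e : PVar → PTerm C) (d : ℕ) (rs : List (PTerm C)) :
    setAux e d rs ∘ .user = e ∘ .user :=
  funext (setAux_user e d rs)

theorem setAux_of_lt (e : PVar → PTerm C) {d n : ℕ} (h : n < d) (rs : List (PTerm C)) :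
    setAux e d rs (.aux n) = e (.aux n) := by
  induction rs generalizing e d with
  | nil => rfl
  | cons r rs ih =>
    rw [setAux, ih _ (by omega), Function.update_of_ne]
    simpa using h.ne

theorem map_setAux (e : PVar → PTerm C) (d : ℕ) (rs : List (PTerm C)) :
    (List.range' d rs.length).map (setAux e d rs ∘ .aux) = rs := by
  induction rs generalizing e d with
  | nil => rfl
  | cons r rs ih =>
    simp only [List.length_cons, List.range'_succ, List.map_cons, setAux, ih, Function.comp]
    rw [setAux_of_lt _ (by omega), Function.update_self]

theorem auxVars_succ (d k : ℕ) : auxVars d (k + 1) = .aux d :: auxVars (d + 1) k := by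
  simp [auxVars, List.range'_succ]

theorem evalList_auxVars (e : PVar → PTerm C) (z : ℕ → ℤ) (d k : ℕ) :
    FTerm.evalList e z ((auxVars d k).map .var) = (List.range' d k).map (e ∘ .aux) := by
  induction k generalizing d with
  | zero => simp [auxVars, FTerm.evalList]
  | succ k ih => simp [auxVars_succ, FTerm.evalList, FTerm.eval, ih, List.range'_succ]

-- Sets of values and the variables they depend on

theorem mem_poolValues {θ : ℕ → PTerm C} {ts : List (Term C)} {r : PTerm C} :
    r ∈ poolValues θ ts ↔ ∃ t ∈ ts, r ∈ values θ t := by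
  induction ts <;> simp_all [poolValues]

theorem length_of_mem_tupleValues {θ : ℕ → PTerm C} {ts : List (Term C)} {rs : List (PTerm C)}
    (h : rs ∈ tupleValues θ ts) : rs.length = ts.length := by
  induction ts generalizing rs with
  | nil => simp_all [tupleValues]
  | cons t ts ih =>
    obtain ⟨r, -, rs', h', rfl⟩ := h
    simp [ih h']

theorem subset_varsList {t : Term C} {ts : List (Term C)} (h : t ∈ ts) :
    t.vars ⊆ Term.varsList ts := by
  induction ts with
  | nil => simp at h
  | cons s ts ih =>
    rw [Term.varsList]
    rcases List.mem_cons.1 h with rfl | h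
    · exact Finset.subset_union_left
    · exact (ih h).trans Finset.subset_union_right

theorem tupleValues_congr {θ θ' : ℕ → PTerm C} {ts : List (Term C)}
    (h : ∀ t ∈ ts, values θ t = values θ' t) : tupleValues θ ts = tupleValues θ' ts := by
  induction ts <;> simp_all [tupleValues]

theorem poolValues_congr {θ θ' : ℕ → PTerm C} {ts : List (Term C)}
    (h : ∀ t ∈ ts, values θ t = values θ' t) : poolValues θ ts = poolValues θ' ts := by
  induction ts <;> simp_all [poolValues]

theorem values_congr {θ θ' : ℕ → PTerm C} (t : Term C) (h : ∀ x ∈ t.vars, θ x = θ' x) :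
    values θ t = values θ' t := by
  induction t using Term.induct with
  | tuple ts ih =>
    simp only [values]
    rw [tupleValues_congr fun t ht => ih t ht fun x hx => h x (subset_varsList ht hx)]
  | pool ts ih =>
    simp only [values]
    rw [poolValues_congr fun t ht => ih t ht fun x hx => h x (subset_varsList ht hx)]
  | _ => simp_all [values, Term.vars]

theorem Atom.values_congr {θ θ' : ℕ → PTerm C} (a : Atom C) (h : ∀ x ∈ a.vars, θ x = θ' x) :
    a.values θ = a.values θ' := by
  cases a with
  | args p ts =>
    simp only [Atom.values]
    rw [tupleValues_congr fun t ht => ASP.values_congr t fun x hx => h x (subset_varsList ht hx)]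
  | pool p ts =>
    simp only [Atom.values]
    rw [poolValues_congr fun t ht => ASP.values_congr t fun x hx => h x (subset_varsList ht hx)]

-- Freshness of variables, stated semantically

/-- The value of `Z` does not depend on auxiliary program variables and integer variables of
index at least `d`. -/
def FTerm.Fresh (d : ℕ) (Z : FTerm C) : Prop :=
  ∀ (e e' : PVar → PTerm C) (z z' : ℕ → ℤ), (∀ x, e (.user x) = e' (.user x)) →
    (∀ n < d, e (.aux n) = e' (.aux n)) → (∀ i < d, z i = z' i) → Z.eval e z = Z.eval e' z'

theorem FTerm.fresh_ivar {d i : ℕ} (h : i < d) : FTerm.Fresh d (ivar C i) :=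
  fun e e' z z' _ _ hz => by simp [FTerm.eval, IntTerm.eval, hz i h]

theorem FTerm.fresh_aux {d i : ℕ} (h : i < d) : FTerm.Fresh d (.var (.aux i) : FTerm C) :=
  fun e e' z z' _ he _ => by simp [FTerm.eval, he i h]

theorem FTerm.Fresh.eval_update {d i : ℕ} {Z : FTerm C} (hZ : Z.Fresh d) (hi : d ≤ i)
    (e : PVar → PTerm C) (z : ℕ → ℤ) (n : ℤ) : Z.eval e (Function.update z i n) = Z.eval e z :=
  hZ _ _ _ _ (fun _ => rfl) (fun _ _ => rfl) fun j hj => Function.update_of_ne (by omega) _ _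

theorem FTerm.Fresh.eval_setAux {d : ℕ} {Z : FTerm C} (hZ : Z.Fresh d)
    (e : PVar → PTerm C) (z : ℕ → ℤ) (rs : List (PTerm C)) :
    Z.eval (setAux e d rs) z = Z.eval e z :=
  hZ _ _ _ _ (setAux_user e d rs) (fun _ hn => setAux_of_lt e hn rs) fun _ _ => rfl

-- Here-and-there satisfaction of first-order formulas, and σ*

section HereAndThere

variable [LinearOrder (PTerm C)]

/-- Satisfaction in the here-and-there interpretation with the worlds `H` and `T`. -/
def Formula.HT (H T : Interp C P) : Formula C P → (PVar → PTerm C) → (ℕ → ℤ) → Prop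
  | .bot, _, _ => False
  | .top, _, _ => True
  | .pred p ts, e, z => (p, FTerm.evalList e z ts) ∈ H
  | .cmp r s t, e, z => r.Holds (s.eval e z) (t.eval e z)
  | .neg F, e, z => ¬ F.Sat T e z
  | .and F G, e, z => F.HT H T e z ∧ G.HT H T e z
  | .or F G, e, z => F.HT H T e z ∨ G.HT H T e z
  | .imp F G, e, z => (F.HT H T e z → G.HT H T e z) ∧ (F.Sat T e z → G.Sat T e z)
  | .all x F, e, z => ∀ r, F.HT H T (Function.update e x r) z
  | .ex x F, e, z => ∃ r, F.HT H T (Function.update e x r) z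
  | .allInt i F, e, z => ∀ n, F.HT H T e (Function.update z i n)
  | .exInt i F, e, z => ∃ n, F.HT H T e (Function.update z i n)

/-- With equal worlds the two halves of the implication clause coincide. Used backwards, this turns
classical satisfaction into `HT T T`, so the facts on quantifiers and connectives are needed for
`HT` only. -/
theorem Formula.ht_self (T : Interp C P) (F : Formula C P) (e : PVar → PTerm C) (z : ℕ → ℤ) :
    F.HT T T e z ↔ F.Sat T e z := by
  induction F generalizing e z <;> simp_all [Formula.HT, Formula.Sat]

theorem Formula.sat_primed (I : Interp C (Primed P)) (F : Formula C P) (e : PVar → PTerm C)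
    (z : ℕ → ℤ) : F.primed.Sat I e z ↔ F.Sat (primePart I) e z := by
  unfold Formula.primed
  induction F generalizing e z <;> simp_all [Formula.mapPred, Formula.Sat, primePart]

/-- The clauses of σ* copy those of `HT`: primed subformulas, which occur under negations and in the
second half of implications, are evaluated in the world `T`. The inclusion of the worlds plays no
role here. -/
theorem Formula.sat_sigmaStar (I : Interp C (Primed P)) (F : Formula C P) (e : PVar → PTerm C)
    (z : ℕ → ℤ) : F.sigmaStar.Sat I e z ↔ F.HT (plainPart I) (primePart I) e z := by
  induction F generalizing e z <;>
    simp_all [Formula.sigmaStar, Formula.Sat, Formula.HT, Formula.sat_primed, plainPart]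

variable {H T : Interp C P} {e : PVar → PTerm C} {z : ℕ → ℤ}

theorem Formula.ht_conj {l : List (Formula C P)} :
    (Formula.conj l).HT H T e z ↔ ∀ F ∈ l, F.HT H T e z := by
  unfold Formula.conj
  induction l <;> simp_all [Formula.HT]

theorem Formula.ht_disj {l : List (Formula C P)} :
    (Formula.disj l).HT H T e z ↔ ∃ F ∈ l, F.HT H T e z := by
  unfold Formula.disj
  induction l <;> simp_all [Formula.HT]

theorem Formula.ht_exList_auxVars {d k : ℕ} {F : Formula C P} :
    (Formula.exList (auxVars d k) F).HT H T e z ↔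
      ∃ rs : List (PTerm C), rs.length = k ∧ F.HT H T (setAux e d rs) z := by
  induction k generalizing e d with
  | zero => simp [auxVars, Formula.exList, setAux]
  | succ k ih =>
    rw [auxVars_succ]
    change (∃ r, (Formula.exList (auxVars (d + 1) k) F).HT H T (Function.update e (.aux d) r) z) ↔ _
    simp only [ih]
    constructor
    · rintro ⟨r, rs, h, h'⟩
      exact ⟨r :: rs, by simp [h], h'⟩
    · rintro ⟨_ | ⟨r, rs⟩, h, h'⟩
      · simp at h
      · exact ⟨r, rs, by simpa using h, h'⟩

theorem Formula.ht_allList_auxVars {d k : ℕ} {F : Formula C P} :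
    (Formula.allList (auxVars d k) F).HT H T e z ↔
      ∀ rs : List (PTerm C), rs.length = k → F.HT H T (setAux e d rs) z := by
  induction k generalizing e d with
  | zero => simp [auxVars, Formula.allList, setAux]
  | succ k ih =>
    rw [auxVars_succ]
    change (∀ r, (Formula.allList (auxVars (d + 1) k) F).HT H T (Function.update e (.aux d) r) z) ↔ _
    simp only [ih]
    constructor
    · rintro h (_ | ⟨r, rs⟩) h'
      · simp at h'
      · exact h r rs (by simpa using h')
    · exact fun h r rs h' => h (r :: rs) (by simp [h'])

theorem Formula.ht_allList {xs : List PVar} {F : Formula C P} :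
    (Formula.allList xs F).HT H T e z ↔
      ∀ e' : PVar → PTerm C, (∀ x ∉ xs, e' x = e x) → F.HT H T e' z := by
  induction xs generalizing e with
  | nil =>
    refine ⟨fun h e' he => ?_, fun h => h e fun _ _ => rfl⟩
    rwa [show e' = e from funext fun x => he x List.not_mem_nil]
  | cons x xs ih =>
    change (∀ r, (Formula.allList xs F).HT H T (Function.update e x r) z) ↔ _
    simp only [ih]
    constructor
    · intro h e' he
      -- Giving `x` its final value at once is harmless even if `x` recurs in `xs`.
      refine h (e' x) e' fun y hy => ?_
      by_cases hyx : y = x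
      · simp [hyx]
      · rw [Function.update_of_ne hyx, he y (by simp [hyx, hy])]
    · intro h r e' he
      refine h e' fun y hy => ?_
      simp only [List.mem_cons, not_or] at hy
      rw [he y hy.2, Function.update_of_ne hy.1]

theorem satisfiesPrimeAxioms_iff {I : Interp C (Primed P)} :
    SatisfiesPrimeAxioms I ↔ plainPart I ⊆ primePart I := by
  simp only [SatisfiesPrimeAxioms, Formula.Satisfies, primeAxiom, ← Formula.ht_self,
    Formula.ht_allList_auxVars]
  simp only [Formula.ht_self, Formula.Sat, evalList_auxVars]
  constructor
  · rintro h ⟨p, rs⟩ hp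
    -- The axiom is closed, so any assignment will do.
    have := h p rs.length (fun _ => .inf) (fun _ => 0) rs rfl
    rw [map_setAux] at this
    exact this hp
  · rintro h p _ e _ rs rfl
    rw [map_setAux]
    exact fun hp => @h (p, rs) hp

end HereAndThere

-- The formulas val_t define the sets of values

section Val

variable [LinearOrder (PTerm C)]

theorem IsTermOrder.num_le_num (hC : IsTermOrder C) {m n : ℤ} :
    (PTerm.num m : PTerm C) ≤ PTerm.num n ↔ m ≤ n := by
  rw [← not_lt, hC.num_lt_num, not_lt]

/-- Division with remainder in `{0, …, |n| - 1}` is unique, and `/` and `%` on `ℤ` follow this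
convention for negative divisors too. -/
theorem division_iff {m n q r : ℤ} :
    (m = n * q + r ∧ n ≠ 0 ∧ 0 ≤ r ∧ (r < n ∨ r < -n)) ↔ n ≠ 0 ∧ q = m / n ∧ r = m % n := by
  constructor
  · rintro ⟨h, h0, hr, h'⟩
    have := (Int.ediv_emod_unique'' h0 (a := m) (r := r) (q := q)).2
      ⟨by rw [h, add_comm], hr, lt_abs.2 h'⟩
    exact ⟨h0, this.1.symm, this.2.symm⟩
  · rintro ⟨h0, rfl, rfl⟩
    exact ⟨(Int.mul_ediv_add_emod m n).symm, h0, Int.emod_nonneg _ h0,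
      lt_abs.1 (Int.emod_lt_abs _ h0)⟩

/-- The formula `val_t` expresses that its argument is a value of `t`. -/
def ValCorrect (H T : Interp C C) (t : Term C) : Prop :=
  ∀ (d : ℕ) (Z : FTerm C) (e : PVar → PTerm C) (z : ℕ → ℤ), Z.Fresh d →
    ((val d t Z).HT H T e z ↔ Z.eval e z ∈ values (e ∘ .user) t)

variable {H T : Interp C C}

theorem ht_valList {ts : List (Term C)} (h : ∀ t ∈ ts, ValCorrect H T t) {d i : ℕ}
    (hd : i + ts.length ≤ d) {e : PVar → PTerm C} {z : ℕ → ℤ} :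
    (∀ F ∈ valList d i ts, F.HT H T e z) ↔
      (List.range' i ts.length).map (e ∘ .aux) ∈ tupleValues (e ∘ .user) ts := by
  induction ts generalizing i with
  | nil => simp [valList, tupleValues]
  | cons t ts ih =>
    simp only [List.length_cons] at hd
    simp only [valList, List.forall_mem_cons, List.length_cons, List.range'_succ, List.map_cons]
    rw [ih (fun t ht => h t (List.mem_cons_of_mem _ ht)) (by omega),
      h t List.mem_cons_self _ _ _ _ (FTerm.fresh_aux (by omega))]
    simp [tupleValues, FTerm.eval]

theorem ht_zipWith_valList {ts : List (Term C)} (h : ∀ t ∈ ts, ValCorrect H T t) {d i : ℕ}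
    (hd : i + ts.length ≤ d) {e : PVar → PTerm C} {z : ℕ → ℤ} {Z : FTerm C} :
    (∃ F ∈ List.zipWith (fun F I => Formula.and F (.cmp .eq Z (.var I)))
        (valList d i ts) (auxVars i ts.length), F.HT H T e z) ↔
      ∃ j, ∃ h : j < ts.length,
        e (.aux (i + j)) ∈ values (e ∘ .user) ts[j] ∧ Z.eval e z = e (.aux (i + j)) := by
  induction ts generalizing i with
  | nil => simp [valList]
  | cons t ts ih =>
    simp only [List.length_cons] at hd
    simp only [valList, List.length_cons, auxVars_succ, List.zipWith_cons_cons,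
      List.exists_mem_cons_iff]
    rw [ih (fun t ht => h t (List.mem_cons_of_mem _ ht)) (by omega), Formula.HT,
      h t List.mem_cons_self _ _ _ _ (FTerm.fresh_aux (by omega))]
    simp only [Formula.HT, Rel.Holds, FTerm.eval]
    constructor
    · rintro (h | ⟨j, hj, h⟩)
      · exact ⟨0, by omega, h⟩
      · exact ⟨j + 1, by omega, by simpa [show i + 1 + j = i + (j + 1) by omega] using h⟩
    · rintro ⟨_ | j, hj, h⟩
      · exact Or.inl h
      · exact Or.inr ⟨j, by omega, by simpa [show i + 1 + j = i + (j + 1) by omega] using h⟩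

/-- Induction on the term, for all `d` and `Z` at once, as subterms are translated with a larger
index and another argument. Freshness ensures that the newly bound variables do not change the value
of `Z`. No predicate symbol occurs in these formulas, so the worlds are arbitrary. -/
theorem valCorrect (hC : IsTermOrder C) (t : Term C) : ValCorrect H T t := by
  induction t using Term.induct with
  | arith o s t hs ht =>
    intro d Z e z hZ
    simp only [val, Formula.HT, Formula.ht_conj, List.forall_mem_cons, List.not_mem_nil,
      false_imp_iff, implies_true, and_true, values, Set.mem_ofPred_eq,
      hs _ _ _ _ (FTerm.fresh_ivar (show d < d + 2 by omega)),
      ht _ _ _ _ (FTerm.fresh_ivar (show d + 1 < d + 2 by omega)),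
      hZ.eval_update (show d ≤ d + 1 by omega), hZ.eval_update le_rfl]
    simp only [FTerm.eval, IntTerm.eval, Rel.Holds, Function.update_self, ne_eq, Nat.left_eq_add, 
      one_ne_zero, not_false_eq_true, Function.update_of_ne]
    exact exists₂_congr fun m n => by tauto
  | div s t hs ht =>
    intro d Z e z hZ
    simp only [val, divisionCondition, List.cons_append, List.nil_append,
      Formula.HT, Formula.ht_conj, List.forall_mem_cons, List.not_mem_nil,
      false_imp_iff, implies_true, and_true, values, Set.mem_ofPred_eq,
      hs _ _ _ _ (FTerm.fresh_ivar (show d < d + 4 by omega)),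
      ht _ _ _ _ (FTerm.fresh_ivar (show d + 1 < d + 4 by omega)),
      hZ.eval_update (show d ≤ d + 3 by omega), hZ.eval_update (show d ≤ d + 2 by omega),
      hZ.eval_update (show d ≤ d + 1 by omega), hZ.eval_update le_rfl]
    simp [FTerm.eval, IntTerm.eval, Rel.Holds, Op.apply, hC.num_lt_num, hC.num_le_num]
    constructor
    -- The dividend has been eliminated by the equation I = J × Q + R; it is now `n * q + r`.
    · rintro ⟨n, q, r, hm, hn, h0, hr, hr', h⟩
      obtain ⟨-, hq, -⟩ := division_iff.1 ⟨rfl, h0, hr, hr'⟩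
      exact ⟨_, hm, n, hn, h0, by rw [h, ← hq]⟩
    · rintro ⟨m, hm, n, hn, h0, h⟩
      obtain ⟨h1, -, h2, h3⟩ := division_iff.2 ⟨h0, rfl, rfl⟩
      exact ⟨n, m / n, m % n, by rwa [← h1], hn, h0, h2, h3, h⟩
  | mod s t hs ht =>
    intro d Z e z hZ
    simp only [val, divisionCondition, List.cons_append, List.nil_append,
      Formula.HT, Formula.ht_conj, List.forall_mem_cons, List.not_mem_nil,
      false_imp_iff, implies_true, and_true, values, Set.mem_ofPred_eq,
      hs _ _ _ _ (FTerm.fresh_ivar (show d < d + 4 by omega)),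
      ht _ _ _ _ (FTerm.fresh_ivar (show d + 1 < d + 4 by omega)),
      hZ.eval_update (show d ≤ d + 3 by omega), hZ.eval_update (show d ≤ d + 2 by omega),
      hZ.eval_update (show d ≤ d + 1 by omega), hZ.eval_update le_rfl]
    simp [FTerm.eval, IntTerm.eval, Rel.Holds, Op.apply, hC.num_lt_num, hC.num_le_num]
    constructor
    · rintro ⟨n, q, r, hm, hn, h0, hr, hr', h⟩
      obtain ⟨-, -, hq⟩ := division_iff.1 ⟨rfl, h0, hr, hr'⟩
      exact ⟨_, hm, n, hn, h0, by rw [h, ← hq]⟩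
    · rintro ⟨m, hm, n, hn, h0, h⟩
      obtain ⟨h1, -, h2, h3⟩ := division_iff.2 ⟨h0, rfl, rfl⟩
      exact ⟨n, m / n, m % n, by rwa [← h1], hn, h0, h2, h3, h⟩
  | interval s t hs ht =>
    intro d Z e z hZ
    simp only [val, Formula.HT, Formula.ht_conj, List.forall_mem_cons, List.not_mem_nil,
      false_imp_iff, implies_true, and_true, values, Set.mem_ofPred_eq,
      hs _ _ _ _ (FTerm.fresh_ivar (show d < d + 3 by omega)),
      ht _ _ _ _ (FTerm.fresh_ivar (show d + 1 < d + 3 by omega)),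
      hZ.eval_update (show d ≤ d + 2 by omega),
      hZ.eval_update (show d ≤ d + 1 by omega), hZ.eval_update le_rfl]
    simp [FTerm.eval, IntTerm.eval, Rel.Holds, hC.num_le_num]
  | tuple ts ih =>
    intro d Z e z hZ
    simp only [val, Formula.ht_exList_auxVars, Formula.ht_conj, List.forall_mem_cons,
      ht_valList ih le_rfl, Formula.HT, hZ.eval_setAux, FTerm.eval, evalList_auxVars, Rel.Holds,
      setAux_comp_user, values, Set.mem_ofPred_eq]
    constructor
    · rintro ⟨rs, hl, h, h'⟩
      rw [← hl, map_setAux] at h h'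
      exact ⟨rs, h', h⟩
    · rintro ⟨rs, h', h⟩
      refine ⟨rs, length_of_mem_tupleValues h', ?_⟩
      rw [← length_of_mem_tupleValues h', map_setAux]
      exact ⟨h, h'⟩
  | pool ts ih =>
    intro d Z e z hZ
    simp only [val, Formula.ht_exList_auxVars, Formula.ht_disj, ht_zipWith_valList ih le_rfl,
      hZ.eval_setAux, setAux_comp_user, values, mem_poolValues]
    constructor
    · rintro ⟨rs, hl, j, hj, h, hZ'⟩
      exact ⟨_, List.getElem_mem hj, hZ' ▸ h⟩
    · rintro ⟨t, ht, h⟩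
      obtain ⟨j, hj, rfl⟩ := List.getElem_of_mem ht
      -- All k variables are quantified, but the chosen disjunct constrains only the one with offset
      -- `j`. A list with the value of `Z` in every place is a witness; this reads off its entry
      -- `j`.
      have hr := congrArg (fun l => l[j]?)
        (map_setAux e d (List.replicate ts.length (Z.eval e z)))
      simp only [List.length_replicate, List.getElem?_map, List.getElem?_range' hj,
        List.getElem?_replicate, hj, if_true, Option.map_some, Option.some_inj, one_mul,
        Function.comp_apply] at hr
      exact ⟨List.replicate ts.length (Z.eval e z), by simp, j, hj, by rwa [hr], hr.symm⟩
  | _ => intro d Z e z hZ; simp [val, Formula.HT, Rel.Holds, FTerm.eval, IntTerm.eval, values]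

end Val

-- Reducts of infinitary formulas as here-and-there satisfaction

namespace IForm

variable {A : Type u} {X Y : Set A}

theorem sat_reduct_atom {a : A} : Sat Y (reduct X (atom a)) ↔ a ∈ X ∧ a ∈ Y := by
  by_cases h : a ∈ X <;> simp [reduct, h, Sat, bot]

/-- The reduct replaces false atoms and implications by ⊥, so where `X` falsifies a formula no `Y`
at all satisfies its reduct. This is the persistence property of HT. -/
theorem sat_of_sat_reduct {F : IForm A} (h : Sat Y (reduct X F)) : Sat X F := by
  induction F with
  | atom a => exact (sat_reduct_atom.1 h).1
  | conj f ih => exact fun i => ih i (h i)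
  | disj f ih => exact h.imp ih
  | imp F G ihF ihG =>
    by_contra h'
    rw [reduct, if_neg h'] at h
    simp [bot, Sat] at h

theorem sat_reduct_imp {F G : IForm A} :
    Sat Y (reduct X (imp F G)) ↔
      (Sat Y (reduct X F) → Sat Y (reduct X G)) ∧ (Sat X F → Sat X G) := by
  constructor
  · intro h
    have h' : Sat X (imp F G) := sat_of_sat_reduct h
    rw [reduct, if_pos h'] at h
    exact ⟨h, h'⟩
  · rintro ⟨h, h'⟩
    have h'' : Sat X (imp F G) := h'
    rwa [reduct, if_pos h'']

theorem sat_reduct_bot : ¬ Sat Y (reduct X bot) := by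
  simp [bot, reduct, Sat]

theorem sat_reduct_top : Sat Y (reduct X top) := by
  simp [top, reduct, Sat]

theorem sat_reduct_neg {F : IForm A} : Sat Y (reduct X (neg F)) ↔ ¬ Sat X F := by
  rw [neg, sat_reduct_imp]
  refine ⟨fun h h' => ?_, fun h => ⟨fun h' => absurd (sat_of_sat_reduct h') h, fun h' => absurd h' h⟩⟩
  simpa [bot, Sat] using h.2 h'

theorem sat_reduct_self {F : IForm A} : Sat X (reduct X F) ↔ Sat X F := by
  refine ⟨sat_of_sat_reduct, fun h => ?_⟩
  induction F with
  | atom a => exact sat_reduct_atom.2 ⟨h, h⟩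
  | conj f ih => exact fun i => ih i (h i)
  | disj f ih => exact h.imp ih
  | imp F G ihF ihG => exact sat_reduct_imp.2 ⟨fun h' => ihG (h (sat_of_sat_reduct h')), h⟩

end IForm

/-! ## Rules in here-and-there interpretations -/

variable {H T : Set (GAtom C)} {θ θ' : ℕ → PTerm C}

/-- Satisfaction of an instance of a head in a here-and-there interpretation. -/
def Head.Holds (H T : Set (GAtom C)) (θ : ℕ → PTerm C) : Head C → Prop
  | .basic a => ∀ x ∈ a.values θ, x ∈ H
  | .choice a => ∀ x ∈ a.values θ, x ∈ H ∨ x ∉ T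
  | .empty => False

theorem Head.sat_reduct_ground (h : H ⊆ T) (A : Head C) :
    IForm.Sat H (IForm.reduct T (A.ground θ)) ↔ A.Holds H T θ := by
  cases A with
  | basic a =>
    simp only [Head.ground, Head.Holds]
    refine Iff.trans (forall_congr' fun x => IForm.sat_reduct_atom) ?_
    simp only [Subtype.forall]
    exact forall₂_congr fun x _ => ⟨And.right, fun hx => ⟨h hx, hx⟩⟩
  | choice a =>
    simp only [Head.ground, Head.Holds]
    have key (x : GAtom C) :
        IForm.Sat H (IForm.reduct T (.or (.atom x) (.neg (.atom x)))) ↔ x ∈ H ∨ x ∉ T := by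
      have : IForm.Sat H (IForm.reduct T (.or (.atom x) (.neg (.atom x)))) ↔
          IForm.Sat H (IForm.reduct T (.atom x)) ∨
            IForm.Sat H (IForm.reduct T (.neg (.atom x))) := by
        simp only [IForm.or, IForm.Sat, IForm.reduct, ULift.exists, Bool.exists_bool, cond]
        exact or_comm
      rw [this, IForm.sat_reduct_atom, IForm.sat_reduct_neg, IForm.Sat,
        and_iff_right_of_imp (fun hx => h hx)]
    refine Iff.trans (forall_congr' fun x => key _) ?_
    simp only [Subtype.forall]
  | empty => simp [Head.ground, Head.Holds, IForm.sat_reduct_bot]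

theorem Head.holds_congr (A : Head C)
    (h : ∀ x ∈ A.vars, θ x = θ' x) : A.Holds H T θ ↔ A.Holds H T θ' := by
  rcases A with a | a | _
  rotate_right
  · rfl
  all_goals
    simp only [Head.Holds]
    rw [Atom.values_congr a h]

section RuleSemantics

variable [LinearOrder (PTerm C)]

/-- Satisfaction of an instance of a body expression in a here-and-there interpretation. -/
def BodyExpr.Holds (H T : Set (GAtom C)) (θ : ℕ → PTerm C) : BodyExpr C → Prop
  | .pos a => ∃ x ∈ a.values θ, x ∈ H
  | .naf a => ∃ x ∈ a.values θ, x ∉ T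
  | .nafnaf a => ∃ x ∈ a.values θ, x ∈ T
  | .cmp r s t => ∃ a ∈ values θ s, ∃ b ∈ values θ t, r.Holds a b

/-- Satisfaction of an instance of a rule in a here-and-there interpretation. -/
def Rule.HT (H T : Set (GAtom C)) (θ : ℕ → PTerm C) (R : Rule C) : Prop :=
  ((∀ b ∈ R.body, b.Holds H T θ) → R.head.Holds H T θ) ∧
    ((∀ b ∈ R.body, b.Holds T T θ) → R.head.Holds T T θ)

def Program.IsHTModel (Γ : Program C) (H T : Set (GAtom C)) : Prop :=
  ∀ R ∈ Γ, ∀ θ, R.HT H T θ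

theorem Program.IsHTModel.self {Γ : Program C} (h : Γ.IsHTModel H T) : Γ.IsHTModel T T :=
  fun R hR θ => ⟨(h R hR θ).2, (h R hR θ).2⟩

open Classical in
theorem Program.isHTModel_union {Γ Δ : Program C} :
    Program.IsHTModel (Γ ∪ Δ) H T ↔ Γ.IsHTModel H T ∧ Δ.IsHTModel H T := by
  simp only [Program.IsHTModel, Finset.mem_union, or_imp, forall_and]

theorem BodyExpr.sat_reduct_ground (h : H ⊆ T) (b : BodyExpr C) :
    IForm.Sat H (IForm.reduct T (b.ground θ)) ↔ b.Holds H T θ := by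
  cases b with
  | pos a =>
    simp only [BodyExpr.ground, BodyExpr.Holds, IForm.reduct, IForm.Sat]
    refine Iff.trans (exists_congr fun x => IForm.sat_reduct_atom) ?_
    simp only [Subtype.exists, exists_prop]
    exact exists_congr fun x => and_congr_right fun _ => ⟨And.right, fun hx => ⟨h hx, hx⟩⟩
  | naf a =>
    simp only [BodyExpr.ground, BodyExpr.Holds]
    refine Iff.trans (exists_congr fun x => IForm.sat_reduct_neg) ?_
    simp [IForm.Sat]
  | nafnaf a =>
    simp only [BodyExpr.ground, BodyExpr.Holds]
    refine Iff.trans (exists_congr fun x => IForm.sat_reduct_neg) ?_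
    simp [IForm.Sat, IForm.neg, IForm.bot]
  | cmp r s t =>
    by_cases h' : ∃ a ∈ ASP.values θ s, ∃ b ∈ ASP.values θ t, r.Holds a b
    · rw [BodyExpr.ground, if_pos h']
      exact iff_of_true IForm.sat_reduct_top h'
    · rw [BodyExpr.ground, if_neg h']
      exact iff_of_false IForm.sat_reduct_bot h'

theorem Rule.sat_reduct_ground (h : H ⊆ T) (R : Rule C) :
    IForm.Sat H (IForm.reduct T (R.ground θ)) ↔ R.HT H T θ := by
  have key {U V : Set (GAtom C)} (h : U ⊆ V) : IForm.Sat U (IForm.reduct V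
      (.conj (fun b : {b : BodyExpr C // b ∈ R.body} => b.1.ground θ))) ↔
        ∀ b ∈ R.body, b.Holds U V θ := by
    refine Iff.trans (forall_congr' fun b => b.1.sat_reduct_ground h) ?_
    simp only [Subtype.forall]
  -- The second half of the implication is classical truth in `T`; `sat_reduct_self` presents it as
  -- satisfaction in the pair `(T, T)`, to which the same lemmas apply.
  rw [Rule.ground, IForm.sat_reduct_imp, ← IForm.sat_reduct_self (X := T),
    ← IForm.sat_reduct_self (X := T) (F := R.head.ground θ), key h, key Set.Subset.rfl,
    Head.sat_reduct_ground h, Head.sat_reduct_ground Set.Subset.rfl, Rule.HT]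

/-- This is the description of stable models in equilibrium logic, with reducts eliminated. -/
theorem isAnswerSet_iff {Γ : Program C} {X : Set (GAtom C)} :
    IsAnswerSet Γ X ↔ Γ.IsHTModel X X ∧ ∀ Y ⊆ X, Γ.IsHTModel Y X → X ⊆ Y := by
  have key {Y : Set (GAtom C)} (h : Y ⊆ X) :
      (∀ F ∈ Program.ground Γ, IForm.Sat Y (IForm.reduct X F)) ↔ Γ.IsHTModel Y X := by
    simp only [Program.ground, Set.mem_ofPred_eq, Program.IsHTModel, ← Rule.sat_reduct_ground h]
    exact ⟨fun hF R hR θ => hF _ ⟨R, hR, θ, rfl⟩, fun hF F ⟨R, hR, θ, e⟩ => e ▸ hF R hR θ⟩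
  rw [IsAnswerSet, IForm.IsStableModel, Minimal, key Set.Subset.rfl]
  exact and_congr_right fun _ =>
    ⟨fun h Y hY h' => h ((key hY).2 h') hY, fun h Y h' hY => h Y hY ((key hY).1 h')⟩

end RuleSemantics

/-! ## Correctness of `τ*` -/

theorem exists_mem_tupleValues_singleton {t : Term C}
    {M : List (PTerm C) → Prop} :
    (∃ rs ∈ tupleValues θ [t], M rs) ↔ ∃ r ∈ values θ t, M [r] := by
  simp [tupleValues]

theorem forall_mem_tupleValues_singleton {t : Term C}
    {M : List (PTerm C) → Prop} :
    (∀ rs ∈ tupleValues θ [t], M rs) ↔ ∀ r ∈ values θ t, M [r] := by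
  simpa using not_congr (exists_mem_tupleValues_singleton (M := fun rs => ¬ M rs))

theorem Atom.exists_mem_values_args {p : C} {ts : List (Term C)}
    {M : GAtom C → Prop} :
    (∃ x ∈ (Atom.args p ts).values θ, M x) ↔ ∃ rs ∈ tupleValues θ ts, M (p, rs) := by
  simp only [Atom.values, Set.mem_ofPred_eq]
  exact ⟨fun ⟨_, ⟨rs, h, e⟩, h'⟩ => ⟨rs, h, e ▸ h'⟩, fun ⟨rs, h, h'⟩ => ⟨_, ⟨rs, h, rfl⟩, h'⟩⟩

theorem Atom.exists_mem_values_pool {p : C} {ts : List (Term C)}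
    {M : GAtom C → Prop} :
    (∃ x ∈ (Atom.pool p ts).values θ, M x) ↔ ∃ t ∈ ts, ∃ r ∈ ASP.values θ t, M (p, [r]) := by
  simp only [Atom.values, Set.mem_ofPred_eq, mem_poolValues]
  exact ⟨fun ⟨_, ⟨r, ⟨t, h, h''⟩, e⟩, h'⟩ => ⟨t, h, r, h'', e ▸ h'⟩,
    fun ⟨t, h, r, h'', h'⟩ => ⟨_, ⟨r, ⟨t, h, h''⟩, rfl⟩, h'⟩⟩

theorem Atom.forall_mem_values_args {p : C} {ts : List (Term C)}
    {M : GAtom C → Prop} :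
    (∀ x ∈ (Atom.args p ts).values θ, M x) ↔ ∀ rs ∈ tupleValues θ ts, M (p, rs) := by
  simpa using not_congr (Atom.exists_mem_values_args (M := fun x => ¬ M x))

theorem Atom.forall_mem_values_pool {p : C} {ts : List (Term C)}
    {M : GAtom C → Prop} :
    (∀ x ∈ (Atom.pool p ts).values θ, M x) ↔ ∀ t ∈ ts, ∀ r ∈ ASP.values θ t, M (p, [r]) := by
  simpa using not_congr (Atom.exists_mem_values_pool (M := fun x => ¬ M x))

theorem update_aux_comp_user (e : PVar → PTerm C) (n : ℕ) (r : PTerm C) :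
    Function.update e (.aux n) r ∘ .user = e ∘ .user :=
  funext fun _ => Function.update_of_ne (by simp) _ _

theorem Rule.mem_vars {R : Rule C} {x : ℕ} :
    x ∈ R.vars ↔ x ∈ R.head.vars ∨ ∃ b ∈ R.body, x ∈ b.vars := by
  rw [Rule.vars]
  induction R.body with
  | nil => simp
  | cons b l ih =>
    simp only [List.foldr_cons, Finset.mem_union, ih, List.exists_mem_cons_iff]
    tauto

section TauStar

variable [LinearOrder (PTerm C)] {e : PVar → PTerm C} {z : ℕ → ℤ}

theorem ht_exVal (hC : IsTermOrder C) {ts : List (Term C)} {F : List (FTerm C) → Formula C C} :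
    (exVal ts F).HT H T e z ↔ ∃ rs ∈ tupleValues (e ∘ .user) ts,
      (F ((auxVars 0 rs.length).map .var)).HT H T (setAux e 0 rs) z := by
  rw [exVal, Formula.ht_exList_auxVars]
  simp only [Formula.ht_conj, List.forall_mem_append, List.forall_mem_singleton,
    ht_valList (fun t _ => valCorrect hC t) (Nat.zero_add _).le, setAux_comp_user]
  constructor
  · rintro ⟨rs, hl, h, h'⟩
    rw [← hl, map_setAux] at h
    exact ⟨rs, h, hl ▸ h'⟩
  · rintro ⟨rs, h, h'⟩
    have hl := length_of_mem_tupleValues h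
    refine ⟨rs, hl, ?_, hl ▸ h'⟩
    rwa [← hl, map_setAux]

/-- The antecedent says the same in both worlds, so the HT implication leaves the consequent to be
satisfied in `(H, T)` and in `(T, T)`. -/
theorem ht_allVal (hC : IsTermOrder C) {ts : List (Term C)} {F : List (FTerm C) → Formula C C} :
    (allVal ts F).HT H T e z ↔ ∀ rs ∈ tupleValues (e ∘ .user) ts,
      (F ((auxVars 0 rs.length).map .var)).HT H T (setAux e 0 rs) z ∧
        (F ((auxVars 0 rs.length).map .var)).HT T T (setAux e 0 rs) z := by
  rw [allVal, Formula.ht_allList_auxVars]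
  simp only [Formula.HT, ← Formula.ht_self, Formula.ht_conj,
    ht_valList (fun t _ => valCorrect hC t) (Nat.zero_add _).le, setAux_comp_user]
  constructor
  · intro h rs hrs
    have hl := length_of_mem_tupleValues hrs
    have h := h rs hl
    rw [← hl, map_setAux] at h
    exact ⟨h.1 hrs, h.2 hrs⟩
  · rintro h rs hl
    rw [← hl, map_setAux]
    exact ⟨fun h' => (h rs h').1, fun h' => (h rs h').2⟩

theorem BodyExpr.ht_tauB (hC : IsTermOrder C) (b : BodyExpr C) :
    b.tauB.HT H T e z ↔ b.Holds H T (e ∘ .user) := by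
  rcases b with a | a | a | ⟨r, s, t⟩
  rotate_right
  · simp only [BodyExpr.tauB, BodyExpr.Holds, Formula.HT, Formula.ht_conj, List.forall_mem_cons,
      List.not_mem_nil, false_imp_iff, implies_true, and_true,
      valCorrect hC _ _ _ _ _ (FTerm.fresh_aux (show 0 < 2 by omega)),
      valCorrect hC _ _ _ _ _ (FTerm.fresh_aux (show 1 < 2 by omega)), update_aux_comp_user,
      FTerm.eval, Function.update_self, ne_eq, PVar.aux.injEq, zero_ne_one, not_false_eq_true,
      Function.update_of_ne]
    exact exists_congr fun a =>
      ⟨fun ⟨b, h, h', h''⟩ => ⟨h, b, h', h''⟩, fun ⟨h, b, h', h''⟩ => ⟨b, h, h', h''⟩⟩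
  all_goals
    cases a <;>
    simp only [BodyExpr.tauB, BodyExpr.Holds, ht_exVal hC, Formula.ht_disj, List.mem_map, exists_exists_and_eq_and,
      exists_mem_tupleValues_singleton, Formula.HT, Formula.Sat, evalList_auxVars, map_setAux,
      Atom.exists_mem_values_args, Atom.exists_mem_values_pool, not_not]

theorem Head.ht_tauH (hC : IsTermOrder C) (h : H ⊆ T) (A : Head C) :
    A.tauH.HT H T e z ↔ A.Holds H T (e ∘ .user) := by
  rcases A with a | a | _
  rotate_right
  · rfl
  all_goals
    cases a <;>
    simp only [Head.tauH, Head.Holds, ht_allVal hC, Formula.ht_conj, List.forall_mem_map,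
      forall_mem_tupleValues_singleton, Formula.HT, Formula.Sat, evalList_auxVars, map_setAux,
      Atom.forall_mem_values_args, Atom.forall_mem_values_pool, em, and_true]
  -- For basic heads the extra condition at `T` follows from `H ⊆ T`; for choices it was excluded
  -- middle.
  · exact forall₂_congr fun x _ => and_iff_left_of_imp fun hx => h hx
  · exact forall₂_congr fun t _ => forall₂_congr fun x _ => and_iff_left_of_imp fun hx => h hx

theorem BodyExpr.holds_congr (b : BodyExpr C)
    (h : ∀ x ∈ b.vars, θ x = θ' x) : b.Holds H T θ ↔ b.Holds H T θ' := by
  rcases b with a | a | a | ⟨r, s, t⟩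
  rotate_right
  · simp only [BodyExpr.vars, Finset.mem_union] at h
    simp only [BodyExpr.Holds]
    rw [values_congr s fun x hx => h x (Or.inl hx), values_congr t fun x hx => h x (Or.inr hx)]
  all_goals
    simp only [BodyExpr.Holds]
    rw [Atom.values_congr a h]

/-- This bridges the universal closure, which quantifies only the variables of the rule, and
grounding, which uses substitutions for all variables. -/
theorem Rule.ht_congr (R : Rule C) (h : ∀ x ∈ R.vars, θ x = θ' x) :
    R.HT H T θ ↔ R.HT H T θ' := by
  have hH (x) (hx : x ∈ R.head.vars) : θ x = θ' x := h x (Rule.mem_vars.2 (Or.inl hx))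
  have hB (U : Set (GAtom C)) : (∀ b ∈ R.body, b.Holds U T θ) ↔ ∀ b ∈ R.body, b.Holds U T θ' :=
    forall₂_congr fun b hb => b.holds_congr fun x hx => h x (Rule.mem_vars.2 (Or.inr ⟨b, hb, hx⟩))
  rw [Rule.HT, Rule.HT, hB, hB, R.head.holds_congr hH, R.head.holds_congr (H := T) hH]

theorem Rule.ht_tauStar (hC : IsTermOrder C) (h : H ⊆ T) (R : Rule C) :
    R.tauStar.HT H T e z ↔ ∀ θ, R.HT H T θ := by
  rw [Rule.tauStar, Formula.ht_allList]
  simp only [Formula.HT, ← Formula.ht_self, Formula.ht_conj, List.forall_mem_map,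
    BodyExpr.ht_tauB hC, Head.ht_tauH hC h, Head.ht_tauH hC Set.Subset.rfl]
  constructor
  · intro hR θ
    -- The closure permits changes of `e` only at variables of the rule, so `θ` is followed only
    -- there.
    let e' : PVar → PTerm C
      | .user x => if x ∈ R.vars then θ x else e (.user x)
      | .aux n => e (.aux n)
    refine (R.ht_congr fun x hx => ?_).1 (hR e' ?_)
    · simp [e', hx]
    · rintro (x | n) hx
      · have : x ∉ R.vars := fun h' => hx (List.mem_map_of_mem ((Finset.mem_sort _).2 h'))
        simp [e', this]
      · rfl
  · exact fun hR e' _ => hR _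

theorem Program.ht_tauStar (hC : IsTermOrder C) (h : H ⊆ T) (Γ : Program C) :
    (Formula.conjSet Γ.tauStar).HT H T e z ↔ Γ.IsHTModel H T := by
  simp only [Formula.conjSet, Formula.ht_conj, Finset.mem_toList, Program.tauStar,
    Finset.forall_mem_image, Rule.ht_tauStar hC h]
  rfl

end TauStar

variable {H' T' : Set (GAtom C)}

/-! ## Lists of distinct variables -/

/-- The variables with the indices `i, …, i + k - 1`, as program terms. -/
def varTerms (C : Type u) (i k : ℕ) : List (Term C) := (List.range' i k).map .var

theorem mem_tupleValues_varTerms {i k : ℕ} {rs : List (PTerm C)} :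
    rs ∈ tupleValues θ (varTerms C i k) ↔ rs = (List.range' i k).map θ := by
  induction k generalizing i rs with
  | zero => simp [varTerms, tupleValues]
  | succ k ih =>
    simp only [varTerms] at ih ⊢
    simp [List.range'_succ, tupleValues, values, ih]

theorem mem_values_varTerms {p : C} {i k : ℕ} {x : GAtom C} :
    x ∈ (Atom.args p (varTerms C i k)).values θ ↔ x = (p, (List.range' i k).map θ) := by
  simp [Atom.values, mem_tupleValues_varTerms]

theorem exists_assignment (rs rs' : List (PTerm C)) :
    ∃ θ : ℕ → PTerm C, (List.range' 0 rs.length).map θ = rs ∧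
      (List.range' rs.length rs'.length).map θ = rs' := by
  refine ⟨fun n => ((rs ++ rs')[n]?).getD .inf, List.ext_getElem (by simp) ?_,
    List.ext_getElem (by simp) ?_⟩
  · intro n h h'
    simp [List.getElem?_append_left h', h']
  · intro n h h'
    simp [h']

theorem forall_assignment {k : ℕ} {M : List (PTerm C) → Prop} :
    (∀ θ : ℕ → PTerm C, M ((List.range' 0 k).map θ)) ↔ ∀ rs, rs.length = k → M rs := by
  constructor
  · rintro h rs rfl
    obtain ⟨θ, h1, -⟩ := exists_assignment rs []
    simpa [h1] using h θ
  · exact fun h θ => h _ (by simp)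

/-- The two blocks of indices are disjoint, so their values can be prescribed independently. -/
theorem forall_assignment₂ {k m : ℕ} {M : List (PTerm C) → List (PTerm C) → Prop} :
    (∀ θ : ℕ → PTerm C, M ((List.range' 0 k).map θ) ((List.range' k m).map θ)) ↔
      ∀ rs rs', rs.length = k → rs'.length = m → M rs rs' := by
  constructor
  · rintro h rs rs' rfl rfl
    obtain ⟨θ, h1, h2⟩ := exists_assignment rs rs'
    simpa [h1, h2] using h θ
  · exact fun h θ => h _ _ (by simp) (by simp)

/-- Number the elements of `N` injectively and embed `ℕ` into the infinite complement. Injectivity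
on `N` suffices, since only names from `N` are to be copied. -/
theorem exists_fresh_renaming [Infinite C] {N : Set C} (hN : N.Finite) :
    ∃ h : C → C, (∀ c, h c ∉ N) ∧ Set.InjOn h N := by
  obtain ⟨f, hf⟩ := Set.countable_iff_exists_injOn.1 hN.countable
  have : Infinite ↥Nᶜ := hN.infinite_compl.to_subtype
  refine ⟨fun c => Infinite.natEmbedding ↥Nᶜ (f c), fun c => (Infinite.natEmbedding ↥Nᶜ (f c)).2,
    fun a ha b hb e => hf ha hb ((Infinite.natEmbedding ↥Nᶜ).injective (Subtype.ext e))⟩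

/-! ## Predicate symbols of a program -/

/-- The predicate symbol (name and arity) of a precomputed atom. -/
def gsig (x : GAtom C) : C × ℕ := (x.1, x.2.length)

def Atom.sig : Atom C → C × ℕ
  | .args p ts => (p, ts.length)
  | .pool p _ => (p, 1)

def BodyExpr.sigs : BodyExpr C → Set (C × ℕ)
  | .pos a => {a.sig}
  | .naf a => {a.sig}
  | .nafnaf a => {a.sig}
  | .cmp _ _ _ => ∅

def Head.sigs : Head C → Set (C × ℕ)
  | .basic a => {a.sig}
  | .choice a => {a.sig}
  | .empty => ∅

/-- The predicate symbols that occur in a rule. -/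
def Rule.sigs (R : Rule C) : Set (C × ℕ) := R.head.sigs ∪ ⋃ b ∈ R.body, b.sigs

/-- The predicate symbols that occur in a program. -/
def Program.sigs (Γ : Program C) : Set (C × ℕ) := ⋃ R ∈ Γ, R.sigs

theorem Program.finite_sigs (Γ : Program C) : Γ.sigs.Finite := by
  refine Γ.finite_toSet.biUnion fun R _ => Set.Finite.union ?_ (R.body.finite_toSet.biUnion ?_)
  · cases R.head <;> simp [Head.sigs]
  · rintro (_ | _ | _ | _) _ <;> simp [BodyExpr.sigs]

theorem Atom.gsig_of_mem_values {a : Atom C} {x : GAtom C} (h : x ∈ a.values θ) :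
    gsig x = a.sig := by
  cases a with
  | args p ts =>
    obtain ⟨rs, h, rfl⟩ := h
    simp [gsig, Atom.sig, length_of_mem_tupleValues h]
  | pool p ts =>
    obtain ⟨r, h, rfl⟩ := h
    rfl

theorem Head.holds_congr_sigs (A : Head C) (hH : ∀ x, gsig x ∈ A.sigs → (x ∈ H ↔ x ∈ H'))
    (hT : ∀ x, gsig x ∈ A.sigs → (x ∈ T ↔ x ∈ T')) : A.Holds H T θ ↔ A.Holds H' T' θ := by
  rcases A with a | a | _
  · exact forall₂_congr fun x hx => hH x (Atom.gsig_of_mem_values hx)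
  · exact forall₂_congr fun x hx => or_congr (hH x (Atom.gsig_of_mem_values hx))
      (not_congr (hT x (Atom.gsig_of_mem_values hx)))
  · rfl

variable [LinearOrder (PTerm C)]

theorem BodyExpr.holds_congr_sigs (b : BodyExpr C)
    (hH : ∀ x, gsig x ∈ b.sigs → (x ∈ H ↔ x ∈ H'))
    (hT : ∀ x, gsig x ∈ b.sigs → (x ∈ T ↔ x ∈ T')) : b.Holds H T θ ↔ b.Holds H' T' θ := by
  rcases b with a | a | a | ⟨r, s, t⟩
  · exact exists_congr fun x => and_congr_right fun hx => hH x (Atom.gsig_of_mem_values hx)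
  · exact exists_congr fun x => and_congr_right fun hx =>
      not_congr (hT x (Atom.gsig_of_mem_values hx))
  · exact exists_congr fun x => and_congr_right fun hx => hT x (Atom.gsig_of_mem_values hx)
  · rfl

theorem Rule.ht_congr_sigs (R : Rule C) (hH : ∀ x, gsig x ∈ R.sigs → (x ∈ H ↔ x ∈ H'))
    (hT : ∀ x, gsig x ∈ R.sigs → (x ∈ T ↔ x ∈ T')) : R.HT H T θ ↔ R.HT H' T' θ := by
  have key {U U' : Set (GAtom C)} (hU : ∀ x, gsig x ∈ R.sigs → (x ∈ U ↔ x ∈ U')) :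
      ((∀ b ∈ R.body, b.Holds U T θ) → R.head.Holds U T θ) ↔
        ((∀ b ∈ R.body, b.Holds U' T' θ) → R.head.Holds U' T' θ) := by
    have hb {b : BodyExpr C} (hb : b ∈ R.body) : b.sigs ⊆ R.sigs :=
      (Set.subset_biUnion_of_mem (u := fun b : BodyExpr C => b.sigs) hb).trans
        Set.subset_union_right
    refine imp_congr (forall₂_congr fun b h => ?_) ?_
    · exact b.holds_congr_sigs (fun x hx => hU x (hb h hx)) fun x hx => hT x (hb h hx)
    · exact R.head.holds_congr_sigs (fun x hx => hU x (Or.inl hx)) fun x hx => hT x (Or.inl hx)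
  exact and_congr (key hH) (key hT)

/-- A program cannot see atoms of predicate symbols that it does not contain: adding copies to a
world, or restricting it to the relevant symbols, changes nothing. -/
theorem Program.isHTModel_congr {Γ : Program C} {S : Set (C × ℕ)} (hS : Γ.sigs ⊆ S)
    (hH : ∀ x, gsig x ∈ S → (x ∈ H ↔ x ∈ H')) (hT : ∀ x, gsig x ∈ S → (x ∈ T ↔ x ∈ T')) :
    Γ.IsHTModel H T ↔ Γ.IsHTModel H' T' := by
  refine forall₂_congr fun R hR => forall_congr' fun θ => ?_
  have hR' : R.sigs ⊆ S :=
    (Set.subset_biUnion_of_mem (u := fun R : Rule C => R.sigs) hR).trans hS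
  exact R.ht_congr_sigs (fun x hx => hH x (hR' hx)) fun x hx => hT x (hR' hx)

/-! ## A finite context that distinguishes programs with different here-and-there models -/

/-- The copy of a precomputed atom under a renaming of predicate names. -/
def copy (h : C → C) (x : GAtom C) : GAtom C := (h x.1, x.2)

/-- `{h(p)(Z)}` -/
def copyChoice (h : C → C) (s : C × ℕ) : Rule C :=
  ⟨.choice (.args (h s.1) (varTerms C 0 s.2)), []⟩

/-- `p(Z) ← h(p)(Z)` -/
def copyRule (h : C → C) (s : C × ℕ) : Rule C :=
  ⟨.basic (.args s.1 (varTerms C 0 s.2)), [.pos (.args (h s.1) (varTerms C 0 s.2))]⟩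

/-- `p(Z) ← not not p(Z) ∧ q(W) ∧ not h(q)(W)` -/
def saturationRule (h : C → C) (s t : C × ℕ) : Rule C :=
  ⟨.basic (.args s.1 (varTerms C 0 s.2)),
    [.nafnaf (.args s.1 (varTerms C 0 s.2)), .pos (.args t.1 (varTerms C s.2 t.2)),
      .naf (.args (h t.1) (varTerms C s.2 t.2))]⟩

theorem ht_copyChoice {h : C → C} {s : C × ℕ} :
    (∀ θ, (copyChoice h s).HT H T θ) ↔ ∀ x, gsig x = s → copy h x ∈ H ∨ copy h x ∉ T := by
  simp only [copyChoice, Rule.HT, Head.Holds, mem_values_varTerms, List.not_mem_nil,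
    false_imp_iff, implies_true, forall_const, forall_eq, em, and_true]
  rw [forall_assignment (M := fun rs => (h s.1, rs) ∈ H ∨ (h s.1, rs) ∉ T)]
  exact ⟨fun h' x e => by subst e; exact h' x.2 rfl,
    fun h' rs e => h' (s.1, rs) (Prod.ext rfl e)⟩

theorem ht_copyRule {h : C → C} {s : C × ℕ} :
    (∀ θ, (copyRule h s).HT H T θ) ↔
      ∀ x, gsig x = s → (copy h x ∈ H → x ∈ H) ∧ (copy h x ∈ T → x ∈ T) := by
  simp only [copyRule, Rule.HT, Head.Holds, BodyExpr.Holds, mem_values_varTerms,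
    List.forall_mem_singleton, forall_eq, exists_eq_left]
  rw [forall_assignment (M := fun rs => ((h s.1, rs) ∈ H → (s.1, rs) ∈ H) ∧
    ((h s.1, rs) ∈ T → (s.1, rs) ∈ T))]
  exact ⟨fun h' x e => by subst e; exact h' x.2 rfl,
    fun h' rs e => h' (s.1, rs) (Prod.ext rfl e)⟩

/-- Because of `not not` the half of the rule at `T` is a tautology, so the rule only restricts the
smaller world. -/
theorem ht_saturationRule {h : C → C} {s t : C × ℕ} :
    (∀ θ, (saturationRule h s t).HT H T θ) ↔
      ∀ x y, gsig x = s → gsig y = t → x ∈ T → y ∈ H → copy h y ∉ T → x ∈ H := by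
  simp only [saturationRule, Rule.HT, Head.Holds, BodyExpr.Holds, mem_values_varTerms,
    List.forall_mem_cons, List.not_mem_nil, false_imp_iff, implies_true, and_true, forall_eq,
    exists_eq_left, and_imp]
  rw [forall_assignment₂ (M := fun rs rs' => ((s.1, rs) ∈ T → (t.1, rs') ∈ H →
    (h t.1, rs') ∉ T → (s.1, rs) ∈ H) ∧ ((s.1, rs) ∈ T → (t.1, rs') ∈ T →
    (h t.1, rs') ∉ T → (s.1, rs) ∈ T))]
  constructor
  · rintro h' x y rfl rfl
    exact (h' x.2 y.2 rfl rfl).1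
  · rintro h' rs rs' e e'
    exact ⟨h' (s.1, rs) (t.1, rs') (Prod.ext rfl e) (Prod.ext rfl e'), fun hx _ _ => hx⟩

/-- There is a program for which the sets `copy h '' X` can be chosen freely, that contains `X`,
and that collapses here-and-there interpretations whose first world is not contained in `X`. -/
theorem exists_context (h : C → C) {S : Set (C × ℕ)} (hS : S.Finite) :
    ∃ Δ : Program C, ∀ H T : Set (GAtom C), Δ.IsHTModel H T ↔
      (∀ x, gsig x ∈ S → copy h x ∈ H ∨ copy h x ∉ T) ∧
      (∀ x, gsig x ∈ S → (copy h x ∈ H → x ∈ H) ∧ (copy h x ∈ T → x ∈ T)) ∧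
      ∀ x y, gsig x ∈ S → gsig y ∈ S → x ∈ T → y ∈ H → copy h y ∉ T → x ∈ H := by
  have hf : (copyChoice h '' S ∪ copyRule h '' S ∪
      Set.image2 (saturationRule h) S S).Finite :=
    ((hS.image _).union (hS.image _)).union (hS.image2 _ hS)
  refine ⟨hf.toFinset, fun H T => ?_⟩
  simp only [Program.IsHTModel, Set.Finite.mem_toFinset, Set.mem_union, or_imp, forall_and,
    Set.forall_mem_image, Set.forall_mem_image2, ht_saturationRule]
  have h1 : (∀ x ∈ S, ∀ θ, (copyChoice h x).HT H T θ) ↔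
      ∀ x, gsig x ∈ S → copy h x ∈ H ∨ copy h x ∉ T := by
    simp only [ht_copyChoice]
    exact ⟨fun h' x hx => h' _ hx x rfl, fun h' s hs x e => h' x (e ▸ hs)⟩
  have h2 : (∀ x ∈ S, ∀ θ, (copyRule h x).HT H T θ) ↔
      ∀ x, gsig x ∈ S → (copy h x ∈ H → x ∈ H) ∧ (copy h x ∈ T → x ∈ T) := by
    simp only [ht_copyRule]
    exact ⟨fun h' x hx => h' _ hx x rfl, fun h' s hs x e => h' x (e ▸ hs)⟩
  rw [h1, h2, and_assoc]
  simp only [forall_and]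
  refine and_congr_right fun _ => and_congr_right fun _ => ?_
  exact ⟨fun h' x y hx hy => h' _ hx _ hy x y rfl rfl,
    fun h' s hs t ht x y e e' => h' x y (e ▸ hs) (e' ▸ ht)⟩

/-! ## Strong equivalence -/

theorem StronglyEquivalent.symm {Γ₁ Γ₂ : Program C} (h : StronglyEquivalent Γ₁ Γ₂) :
    StronglyEquivalent Γ₂ Γ₁ :=
  fun Γ => (h Γ).symm

theorem StronglyEquivalent.isHTModel_of_gsig_mem [Infinite C] {Γ₁ Γ₂ : Program C}
    (hse : StronglyEquivalent Γ₁ Γ₂) {S : Set (C × ℕ)} (hS : S.Finite) (hS₁ : Γ₁.sigs ⊆ S)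
    (hS₂ : Γ₂.sigs ⊆ S) (hHT : H ⊆ T) (hT : ∀ x ∈ T, gsig x ∈ S) (h₁ : Γ₁.IsHTModel H T) :
    Γ₂.IsHTModel H T := by
  obtain ⟨h, hN, hinj⟩ := exists_fresh_renaming (hS.image Prod.fst)
  obtain ⟨Δ, hΔ⟩ := exists_context h hS
  have hse' (X : Set (GAtom C)) := Set.ext_iff.1 (hse Δ) X
  simp only [Set.mem_ofPred_eq, isAnswerSet_iff, Program.isHTModel_union] at hse'
  have hcopy {x y : GAtom C} (hx : gsig x ∈ S) : copy h y ≠ x := by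
    rintro rfl
    exact hN _ ⟨_, hx, rfl⟩
  have hcopy_inj {x y : GAtom C} (hx : gsig x ∈ S) (hy : gsig y ∈ S)
      (e : copy h x = copy h y) : x = y :=
    Prod.ext (hinj ⟨_, hx, rfl⟩ ⟨_, hy, rfl⟩ (congrArg Prod.fst e)) (congrArg Prod.snd e :)
  -- membership in sets of the form `U ∪ copy h '' X`
  have hbase {U X : Set (GAtom C)} {x : GAtom C} (hx : gsig x ∈ S) :
      x ∈ U ∪ copy h '' X ↔ x ∈ U :=
    ⟨fun hx' => hx'.resolve_right fun ⟨_, _, e⟩ => hcopy hx e, Or.inl⟩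
  have hcop {U X : Set (GAtom C)} (hU : U ⊆ T) (hX : X ⊆ T) {x : GAtom C} (hx : gsig x ∈ S) :
      copy h x ∈ U ∪ copy h '' X ↔ x ∈ X := by
    constructor
    · rintro (hx' | ⟨y, hy, e⟩)
      · exact (hcopy (hT _ (hU hx')) rfl).elim
      · exact hcopy_inj (hT _ (hX hy)) hx e ▸ hy
    · exact fun hx' => Or.inr ⟨x, hx', rfl⟩
  have hloc {Γ : Program C} (hΓ : Γ.sigs ⊆ S) {U V X : Set (GAtom C)} :
      Γ.IsHTModel (U ∪ copy h '' X) (V ∪ copy h '' X) ↔ Γ.IsHTModel U V :=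
    Program.isHTModel_congr hΓ (fun x hx => hbase hx) fun x hx => hbase hx
  have hΔX {X : Set (GAtom C)} (hX : X ⊆ T) :
      Δ.IsHTModel (T ∪ copy h '' X) (T ∪ copy h '' X) := by
    refine (hΔ _ _).2 ⟨fun x _ => em _, fun x hx => ?_, fun x y _ _ hx _ _ => hx⟩
    rw [hcop Set.Subset.rfl hX hx, hbase hx]
    exact ⟨fun hx' => hX hx', fun hx' => hX hx'⟩
  -- In the smaller world the choice rules keep all the chosen copies, and the copy rules then give
  -- back the original atoms.
  have hsub {X U : Set (GAtom C)} (hX : X ⊆ T) (hU : Δ.IsHTModel U (T ∪ copy h '' X)) :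
      X ∪ copy h '' X ⊆ U := by
    obtain ⟨hU1, hU2, -⟩ := (hΔ _ _).1 hU
    have key {x : GAtom C} (hx : x ∈ X) : copy h x ∈ U :=
      (hU1 x (hT x (hX hx))).resolve_right fun hx' => hx' (Or.inr ⟨x, hx, rfl⟩)
    rintro x (hx | ⟨x, hx, rfl⟩)
    · exact (hU2 x (hT x (hX hx))).1 (key hx)
    · exact key hx
  -- With every atom of `T` copied, Δ alone excludes smaller worlds, so only the condition on `(T,
  -- T)` remains.
  have hT₂ : Γ₂.IsHTModel T T := by
    have := ((hse' (T ∪ copy h '' T)).1 ⟨⟨(hloc hS₁).2 h₁.self, hΔX Set.Subset.rfl⟩,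
      fun Y _ hY => hsub Set.Subset.rfl hY.2⟩).1.1
    exact (hloc hS₂).1 this
  by_contra h₂
  -- A competing world `Y` contains H ∪ h(H). If it has an atom of `T` outside `H`, that atom has no
  -- chosen copy and saturation makes `Y` everything; otherwise `Y` agrees with `H` on the symbols
  -- in `S`, where Γ₂ fails.
  have hans := (hse' (T ∪ copy h '' H)).2 ⟨⟨(hloc hS₂).2 hT₂, hΔX hHT⟩, fun Y hYT hY => by
    have hHY := hsub hHT hY.2
    by_cases hy : ∃ y ∈ Y, y ∈ T ∧ y ∉ H
    · obtain ⟨y, hyY, hyT, hyH⟩ := hy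
      refine Set.union_subset (fun x hx => ?_) (Set.subset_union_right.trans hHY)
      refine ((hΔ _ _).1 hY.2).2.2 x y (hT x hx) (hT y hyT) (Or.inl hx) hyY ?_
      rwa [hcop Set.Subset.rfl hHT (hT y hyT)]
    · push Not at hy
      refine (h₂ ((Program.isHTModel_congr hS₂ (fun x hx => ?_) fun x hx => hbase hx).1 hY.1)).elim
      exact ⟨fun hx' => hy x hx' ((hbase hx).1 (hYT hx')), fun hx' => hHY (Or.inl hx')⟩⟩
  -- For Γ₁ the world H ∪ h(H) is a competitor, as every atom of `S` in it has its copy and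
  -- saturation is not triggered. Minimality forces `H = T`, where Γ₂ holds.
  have hTH := hans.2 (H ∪ copy h '' H) (Set.union_subset_union_left _ hHT)
    ⟨(hloc hS₁).2 h₁, (hΔ _ _).2 ⟨fun x hx => ?_, fun x hx => ?_, fun x y hx hy hx' hy' hy'' => ?_⟩⟩
  · have : H = T := hHT.antisymm fun x hx => (hbase (hT x hx)).1 (hTH (Or.inl hx))
    exact h₂ (this ▸ hT₂)
  · rw [hcop hHT hHT hx, hcop Set.Subset.rfl hHT hx]
    exact em _
  · rw [hcop hHT hHT hx, hcop Set.Subset.rfl hHT hx, hbase hx, hbase hx]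
    exact ⟨id, fun hx' => hHT hx'⟩
  · rw [hcop Set.Subset.rfl hHT hy] at hy''
    exact absurd ((hbase hy).1 hy') hy''

/-- Restricting both worlds to the finitely many predicate symbols of the two programs reduces the
general case to the previous one. -/
theorem StronglyEquivalent.isHTModel [Infinite C] {Γ₁ Γ₂ : Program C}
    (hse : StronglyEquivalent Γ₁ Γ₂) (hHT : H ⊆ T) (h₁ : Γ₁.IsHTModel H T) :
    Γ₂.IsHTModel H T := by
  have key {Γ : Program C} (hΓ : Γ.sigs ⊆ Γ₁.sigs ∪ Γ₂.sigs) :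
      Γ.IsHTModel {x ∈ H | gsig x ∈ Γ₁.sigs ∪ Γ₂.sigs} {x ∈ T | gsig x ∈ Γ₁.sigs ∪ Γ₂.sigs} ↔
        Γ.IsHTModel H T :=
    Program.isHTModel_congr hΓ (fun x hx => and_iff_left hx) fun x hx => and_iff_left hx
  exact (key Set.subset_union_right).1 <|
    hse.isHTModel_of_gsig_mem (Γ₁.finite_sigs.union Γ₂.finite_sigs) Set.subset_union_left
      Set.subset_union_right (fun x hx => ⟨hHT hx.1, hx.2⟩) (fun x hx => hx.2)
      ((key Set.subset_union_left).2 h₁)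

/-- Programs are strongly equivalent if and only if they have the same here-and-there models. -/
theorem stronglyEquivalent_iff [Infinite C] {Γ₁ Γ₂ : Program C} :
    StronglyEquivalent Γ₁ Γ₂ ↔
      ∀ H T : Set (GAtom C), H ⊆ T → (Γ₁.IsHTModel H T ↔ Γ₂.IsHTModel H T) := by
  refine ⟨fun h H T hHT => ⟨h.isHTModel hHT, h.symm.isHTModel hHT⟩, fun h Γ => Set.ext fun X => ?_⟩
  simp only [Set.mem_ofPred_eq, isAnswerSet_iff, Program.isHTModel_union, h X X Set.Subset.rfl]
  exact and_congr_right fun _ => forall₂_congr fun Y hY => by rw [h Y X hY]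

/-- The standard interpretation with given extents of the unprimed and of the primed symbols. -/
def primedInterp (H T : Set (GAtom C)) : Interp C (Primed C) :=
  {a | match a.1 with
    | .plain p => (p, a.2) ∈ H
    | .prime p => (p, a.2) ∈ T}

end ASP

-- The main theorem

open ASP
theorem mainTheorem2 {C : Type u} [Infinite C] [LinearOrder (PTerm C)] (hC : IsTermOrder C)
    (Γ₁ Γ₂ : Program C) :
    StronglyEquivalent Γ₁ Γ₂ ↔
      ∀ I : Interp C (Primed C), SatisfiesPrimeAxioms I →
        (Formula.iff (Formula.conjSet (Program.tauStar Γ₁)).sigmaStar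
          (Formula.conjSet (Program.tauStar Γ₂)).sigmaStar).Satisfies I := by
  have key {I : Interp C (Primed C)} (hI : SatisfiesPrimeAxioms I) :
      (Formula.iff (Formula.conjSet (Program.tauStar Γ₁)).sigmaStar
          (Formula.conjSet (Program.tauStar Γ₂)).sigmaStar).Satisfies I ↔
        (Γ₁.IsHTModel (plainPart I) (primePart I) ↔ Γ₂.IsHTModel (plainPart I) (primePart I)) := by
    -- The truth of the translations does not depend on the assignment, and nonemptiness lets
    -- `forall_const` drop the quantifiers over assignments.
    have : Nonempty (PTerm C) := ⟨.inf⟩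
    have hI' := satisfiesPrimeAxioms_iff.1 hI
    simp only [Formula.Satisfies, Formula.iff, Formula.Sat, Formula.sat_sigmaStar,
      Program.ht_tauStar hC hI', forall_const, iff_iff_implies_and_implies]
  rw [stronglyEquivalent_iff]
  constructor
  · exact fun h I hI => (key hI).2 (h _ _ (satisfiesPrimeAxioms_iff.1 hI))
  · intro h H T hHT
    -- The worlds of this interpretation are `H` and `T` by definition, so every pair `H ⊆ T`
    -- arises.
    have hI : SatisfiesPrimeAxioms (primedInterp H T) := satisfiesPrimeAxioms_iff.2 hHT
    exact (key hI).1 (h _ hI)
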